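/- **Rules.** Fix a relational schema whose relation symbols have positive arities. A DisTGD is a rule $\tau=\beta(\vec x)\to\bigvee_{i=1}^n\exists\vec y_i\,\eta_i(\vec x,\vec y_i)$ ($n\ge 1$), where $\beta$ and the $\eta_i$ are finite non-empty conjunctions of constant-free, function-free atoms and $\vec x=\mathrm{vars}(\beta)$; bodies, head conjunctions and heads are treated as sets. It is guarded (a DisGTGD) if some atom of $\beta$ contains all of $\vec x$. A head conjunction $\eta_i$ is full if it contains no existential variable, and $\tau$ is full if all its head conjunctions are. Let $\eta_i'$ be the set of atoms of $\eta_i$ without existential variables; if all $\eta'_i$ are non-empty, the immediate full consequence is $\mathrm{IFC}(\tau)=\beta\to\bigvee_i\eta_i'$, and $\mathrm{IFC}(\Sigma)$ is the set of those that exist for $\tau\in\Sigma$. **Single head normal form.** $\mathrm{SHNF}(\Sigma)$ is obtained by replacing every rule $\tau\in\Sigma$ as above by $\beta\to\bigvee_i\exists\vec y_i\,R_i(\vec x_{i\restriction},\vec y_i)$ and the rules $R_i(\vec x_{i\restriction},\vec y_i)\to H$ for all $i$ and all $H\in\eta_i$, where the $R_i$ are fresh relation symbols (one for each head conjunction of each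 rule) and $\vec x_{i\restriction}$ are the variables of $\vec x$ that occur in $\eta_i$. **Saturation.** The Skolemisation $\mathrm{Sk}$ replaces each existential variable of the $i$-th head conjunction by $f(\vec x)$, where $f$ is a fresh function symbol for that rule, conjunction and variable. Call a single-headed rule with function symbols full if it is function-free, and non-full if its body is function-free and its head contains a functional atom (an atom that contains a function symbol). $\mathrm{VNF}$ renames the variables to $x_1,x_2,\dots$ in the order of their first occurrence in the body. The inference rule (D-EVOLVE) is as follows: given a non-full $\beta\to\eta$, a functional atom $H\in\eta$, a rule $\beta'\to\eta'$ with variables distinct from those of the first (after a renaming), an atom $B'\in\beta'$ such that either $\beta'\to\eta'$ is full and $B'$ is a guard of it, or $B'$ is functional, and a most general unifier $\theta$ of $H$ and $B'$, add $$\mathrm{VNF}\bigl((\beta\cup(\beta'\setminus\{B'\}))\theta\to((\eta\setminus\{H\})\cup\eta')\theta\bigr).$$ $\mathrm{DGSat}_\exists(\Sigma)$ is the closure of $\mathrm{VNF}(\mathrm{Sk}(\mathrm{SHNF}(\Sigma)))$ under (D-EVOLVE), and $\mathrm{DGSat}(\Sigma)=\mathrm{IFC}(\mathrm{DGSat}_\exists(\Sigma))$,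 where a rule with function-free body is read as the DisTGD obtained by replacing its functional terms by existential variables. **Tree-like chase.** Instances are sets of facts $R(\vec c)$ over constants, decomposed into a rooted tree of bags. A chase step in an instance $I$ with $\tau$ and a trigger $h$ mapping $\beta$ into the bag of a node $v$ creates one child instance for each head conjunction $\eta_i$: the facts $h'(\eta_i)$, where $h'$ extends $h$ by distinct constants for $\vec y_i$ not occurring in $I$, are added to $v$ if $\eta_i$ is full and otherwise form a new child node of $v$; then every fact whose constants all occur in some fact of a bag is added to that bag. A chase tree from a set of facts $N$ is a finite tree of instances with root $N$ (decomposed into a single node $r$ with bag $N$) in which the children of every non-leaf are given by a chase step. For a chase tree $T$ from $N$ let $Q^T$ be the disjunction, over its leaves $L$, of the conjunction of the facts in the bag of $r$ in $L$. A chase tree $T'$ models $Q^T$, written $T'\models Q^T$, if each of its leaves contains all facts of some disjunct. **Evolve-completeness.** A set $\Sigma_2$ of full DisTGDs is evolve-complete with respect to a set $\Sigma_1$ of DisTGDs over the same schema if (1) every $\tau\in\mathrm{IFC}(\Sigma_1)$ is in $\Sigma_2$ up to a renaming of variables, and (2) for every chase tree $T$ with root $N$ whose first step fires a non-full rule $\tau_r\in\Sigma_1$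 (in $r$), such that below every child $N^i$ of $N$ given by a non-full head conjunction only full rules of $\Sigma_2$ are fired, and only in the new child $v_i$ of $r$ in $N^i$, and such that the children of $N$ given by full head conjunctions are leaves, there is a chase tree $T'$ from $N$ using only rules of $\Sigma_2$ with $T'\models Q^T$. **Proposition.** For every set $\Sigma$ of disjunctive guarded TGDs, $\mathrm{DGSat}(\Sigma)$ is a set of full DisTGDs that is evolve-complete with respect to $\mathrm{SHNF}(\Sigma)$. -/

import Mathlib

universe u v

/-! ## Relational schemas, atoms, facts -/

/-- A relational schema: relation symbols with positive arities. -/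
structure Schema where
  Rel : Type u
  arity : Rel → ℕ
  arity_pos : ∀ r, 0 < arity r

/-- Atoms `R(t₁, …, tₐ)` whose arguments are taken from `X`. With `X = ℕ` (variables) these are the
function-free, constant-free atoms of rules; with `X` a type of constants they are facts; with
`X = Term S` they are atoms with Skolem terms. -/
@[ext]
structure Atom (S : Schema.{u}) (X : Type v) where
  rel : S.Rel
  args : Fin (S.arity rel) → X

namespace Atom

variable {S : Schema.{u}}

/-- Apply a map to all arguments of an atom. -/
def map {X Y : Type*} (f : X → Y) (A : Atom S X) : Atom S Y := ⟨A.rel, f ∘ A.args⟩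

/-- The variables of a function-free atom. -/
def vars (A : Atom S ℕ) : Finset ℕ := Finset.univ.image A.args

/-- The constants of a fact. -/
def consts {K : Type v} (F : Atom S K) : Set K := Set.range F.args

end Atom

/-- The variables of a conjunction (a finite set) of function-free atoms. -/
def conjVars {S : Schema.{u}} (D : Finset (Atom S ℕ)) : Finset ℕ := D.biUnion Atom.vars

/-! ## Disjunctive tuple-generating dependencies -/

/-- A DisTGD `β(x) → ⋁ᵢ ∃ yᵢ. ηᵢ(x, yᵢ)`. The body, every head conjunction and the head are finite
sets. The universally quantified variables are those of the body; the existentially quantified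
variables of a head conjunction are its variables that do not occur in the body. -/
@[ext]
structure DisTGD (S : Schema.{u}) where
  body : Finset (Atom S ℕ)
  head : Finset (Finset (Atom S ℕ))
  head_nonempty : head.Nonempty
  conj_nonempty : ∀ D ∈ head, D.Nonempty

namespace DisTGD

variable {S : Schema.{u}}

/-- The universally quantified variables. -/
def bodyVars (τ : DisTGD S) : Finset ℕ := conjVars τ.body

/-- The existentially quantified variables of the head conjunction `D`. -/
def exVars (τ : DisTGD S) (D : Finset (Atom S ℕ)) : Finset ℕ := conjVars D \ τ.bodyVars

/-- All variables of the rule. -/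
def vars (τ : DisTGD S) : Finset ℕ := τ.bodyVars ∪ τ.head.biUnion conjVars

/-- The rule is guarded: some body atom contains all variables of the body. -/
def IsGuarded (τ : DisTGD S) : Prop := ∃ G ∈ τ.body, τ.bodyVars ⊆ G.vars

/-- The rule has no existentially quantified variables. -/
def IsFull (τ : DisTGD S) : Prop := ∀ D ∈ τ.head, τ.exVars D = ∅

open Classical in
/-- `τ'` is obtained from `τ` by an injective renaming of the variables. -/
def IsVariant (τ τ' : DisTGD S) : Prop :=
  ∃ ρ : ℕ → ℕ, Set.InjOn ρ (τ.vars : Set ℕ) ∧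
    τ'.body = τ.body.image (Atom.map ρ) ∧
    τ'.head = τ.head.image (fun D => D.image (Atom.map ρ))

/-- The atoms of the head conjunction `D` that contain no existential variable. -/
def fullPart (τ : DisTGD S) (D : Finset (Atom S ℕ)) : Finset (Atom S ℕ) :=
  D.filter (fun A => Disjoint A.vars (τ.exVars D))

/-- The immediate full consequence exists: every head conjunction has a non-empty full part. -/
def HasIFC (τ : DisTGD S) : Prop := ∀ D ∈ τ.head, (τ.fullPart D).Nonempty

open Classical in
/-- The immediate full consequence: keep in each head conjunction the atoms without existential
variables. -/
noncomputable def ifc (τ : DisTGD S) (h : τ.HasIFC) : DisTGD S where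
  body := τ.body
  head := τ.head.image τ.fullPart
  head_nonempty := τ.head_nonempty.image _
  conj_nonempty := by
    intro D hD
    obtain ⟨D', hD', rfl⟩ := Finset.mem_image.1 hD
    exact h D' hD'

end DisTGD

/-- The immediate full consequences of the rules of `Γ`. -/
def IFC {S : Schema.{u}} (Γ : Set (DisTGD S)) : Set (DisTGD S) :=
  {τ' | ∃ τ ∈ Γ, ∃ h : τ.HasIFC, τ' = τ.ifc h}

/-! ## Single head normal form -/

/-- The arguments of the fresh relation symbol for the head conjunction `D` of `τ`: first the
exported variables of `D`, then its existential variables. -/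
def DisTGD.conjArgs {S : Schema.{u}} (τ : DisTGD S) (D : Finset (Atom S ℕ)) : List ℕ :=
  (conjVars D ∩ τ.bodyVars).sort (· ≤ ·) ++ (τ.exVars D).sort (· ≤ ·)

theorem DisTGD.conjArgs_length_pos {S : Schema.{u}} (τ : DisTGD S) (D : Finset (Atom S ℕ))
    (hD : D ∈ τ.head) : 0 < (τ.conjArgs D).length := by
  obtain ⟨A, hA⟩ := τ.conj_nonempty D hD
  have hv : A.args ⟨0, S.arity_pos A.rel⟩ ∈ conjVars D :=
    Finset.mem_biUnion.2 ⟨A, hA, Finset.mem_image_of_mem _ (Finset.mem_univ _)⟩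
  apply List.length_pos_of_mem (a := A.args ⟨0, S.arity_pos A.rel⟩)
  simp only [DisTGD.conjArgs, DisTGD.exVars, List.mem_append, Finset.mem_sort, Finset.mem_inter,
    Finset.mem_sdiff]
  tauto

/-- The schema extended by one fresh relation symbol for every head conjunction of every rule
of `Γ`. -/
def shnfSchema {S : Schema.{u}} (Γ : Set (DisTGD S)) : Schema.{u} where
  Rel := S.Rel ⊕ {p : DisTGD S × Finset (Atom S ℕ) // p.1 ∈ Γ ∧ p.2 ∈ p.1.head}
  arity := Sum.elim S.arity (fun p => (p.1.1.conjArgs p.1.2).length)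
  arity_pos := by
    rintro (r | p)
    · exact S.arity_pos r
    · exact p.1.1.conjArgs_length_pos p.1.2 p.2.2

section SHNF

variable {S : Schema.{u}} {Γ : Set (DisTGD S)}

/-- An atom over the original schema as an atom over the extended one. -/
def liftAtom {X : Type v} (A : Atom S X) : Atom (shnfSchema Γ) X := ⟨Sum.inl A.rel, A.args⟩

/-- The atom `R_D(x↾, y)` for the head conjunction `D` of `τ`. -/
def freshAtom (τ : DisTGD S) (hτ : τ ∈ Γ) (D : Finset (Atom S ℕ)) (hD : D ∈ τ.head) :
    Atom (shnfSchema Γ) ℕ :=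
  ⟨Sum.inr ⟨(τ, D), hτ, hD⟩, fun i => (τ.conjArgs D).get i⟩

open Classical in
/-- The rule `β → ⋁_D ∃ y_D. R_D(x↾, y_D)`. -/
noncomputable def shnfMain (τ : DisTGD S) (hτ : τ ∈ Γ) : DisTGD (shnfSchema Γ) where
  body := τ.body.image liftAtom
  head := τ.head.attach.image (fun D => {freshAtom τ hτ D.1 D.2})
  head_nonempty := (Finset.attach_nonempty_iff.2 τ.head_nonempty).image _
  conj_nonempty := by
    intro D hD
    obtain ⟨D', -, rfl⟩ := Finset.mem_image.1 hD
    exact Finset.singleton_nonempty _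

/-- The rule `R_D(x↾, y_D) → A`, for an atom `A` of `D`. -/
def shnfProj (τ : DisTGD S) (hτ : τ ∈ Γ) (D : Finset (Atom S ℕ)) (hD : D ∈ τ.head)
    (A : Atom S ℕ) : DisTGD (shnfSchema Γ) where
  body := {freshAtom τ hτ D hD}
  head := {{liftAtom A}}
  head_nonempty := Finset.singleton_nonempty _
  conj_nonempty := by
    intro D hD
    rw [Finset.mem_singleton.1 hD]
    exact Finset.singleton_nonempty _

end SHNF

/-- The single head normal form of `Γ`. -/
def SHNF {S : Schema.{u}} (Γ : Set (DisTGD S)) : Set (DisTGD (shnfSchema Γ)) :=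
  {σ | ∃ τ, ∃ hτ : τ ∈ Γ, σ = shnfMain τ hτ ∨
    ∃ D, ∃ hD : D ∈ τ.head, ∃ A ∈ D, σ = shnfProj τ hτ D hD A}

/-! ## Skolem terms and Skolemised rules -/

/-- Skolem function symbols: the symbol for the existential variable `var` of the head conjunction
`conj` of `rule`. -/
structure SkolemSym (S : Schema.{u}) where
  rule : DisTGD S
  conj : Finset (Atom S ℕ)
  var : ℕ

/-- A Skolem function takes all universally quantified variables of its rule as arguments. -/
def SkolemSym.arity {S : Schema.{u}} (f : SkolemSym S) : ℕ := f.rule.bodyVars.card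

/-- Terms over the variables `ℕ` and the Skolem functions (rules are constant-free). -/
inductive Term (S : Schema.{u}) : Type u
  | var (x : ℕ) : Term S
  | app (f : SkolemSym S) (ts : Fin f.arity → Term S) : Term S

namespace Term

variable {S : Schema.{u}}

/-- The list of variables of a term, from left to right. -/
def varList : Term S → List ℕ
  | var x => [x]
  | app _ ts => (List.ofFn (fun i => (ts i).varList)).flatten

/-- Apply a substitution. -/
def subst (θ : ℕ → Term S) : Term S → Term S
  | var x => θ x
  | app f ts => app f (fun i => (ts i).subst θ)

/-- The term is not a variable. -/
def IsFunctional (t : Term S) : Prop := ∀ x, t ≠ var x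

end Term

namespace Atom

variable {S : Schema.{u}}

/-- The list of variables of an atom, from left to right. -/
def varList (A : Atom S (Term S)) : List ℕ :=
  (List.ofFn (fun i => (A.args i).varList)).flatten

/-- Apply a substitution to an atom. -/
def subst (θ : ℕ → Term S) (A : Atom S (Term S)) : Atom S (Term S) := A.map (Term.subst θ)

/-- The atom contains a function. -/
def IsFunctional (A : Atom S (Term S)) : Prop := ∃ i, (A.args i).IsFunctional

/-- `θ` is a unifier of `A` and `B`. -/
def IsUnifier (θ : ℕ → Term S) (A B : Atom S (Term S)) : Prop := A.subst θ = B.subst θ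

/-- `θ` is a most general unifier of `A` and `B`. -/
def IsMGU (θ : ℕ → Term S) (A B : Atom S (Term S)) : Prop :=
  IsUnifier θ A B ∧
    ∀ ρ : ℕ → Term S, IsUnifier ρ A B → ∃ δ : ℕ → Term S, ∀ x, ρ x = (θ x).subst δ

end Atom

/-- A single-headed rule `⋀ body → ⋁ head` over atoms with Skolem terms, all of whose variables
are universally quantified; the head is the finite set of its disjuncts. -/
@[ext]
structure SkRule (S : Schema.{u}) where
  body : Finset (Atom S (Term S))
  head : Finset (Atom S (Term S))

namespace SkRule

variable {S : Schema.{u}}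

/-- The variables of the rule. -/
def vars (σ : SkRule S) : Set ℕ := {x | ∃ A, (A ∈ σ.body ∨ A ∈ σ.head) ∧ x ∈ A.varList}

/-- The rule is full: it is function-free. -/
def IsFull (σ : SkRule S) : Prop :=
  (∀ A ∈ σ.body, ¬ A.IsFunctional) ∧ ∀ A ∈ σ.head, ¬ A.IsFunctional

/-- The rule is non-full: its body is function-free and its head is functional. -/
def IsNonFull (σ : SkRule S) : Prop :=
  (∀ A ∈ σ.body, ¬ A.IsFunctional) ∧ ∃ A ∈ σ.head, A.IsFunctional

/-- `G` is a guard of the rule: a body atom with all variables of the rule. -/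
def IsGuard (σ : SkRule S) (G : Atom S (Term S)) : Prop :=
  G ∈ σ.body ∧ ∀ x ∈ σ.vars, x ∈ G.varList

open Classical in
/-- Apply a substitution to a rule. -/
noncomputable def subst (θ : ℕ → Term S) (σ : SkRule S) : SkRule S :=
  ⟨σ.body.image (Atom.subst θ), σ.head.image (Atom.subst θ)⟩

/-- Rename the variables of a rule. -/
noncomputable def rename (ρ : ℕ → ℕ) (σ : SkRule S) : SkRule S := σ.subst (fun x => Term.var (ρ x))

/-- The variables of the body without repetitions, in the order of their first occurrence when the
body is read from left to right (the set of body atoms being enumerated in a fixed order). -/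
noncomputable def bodyVarList (σ : SkRule S) : List ℕ :=
  ((σ.body.toList.map Atom.varList).flatten.reverse.dedup).reverse

/-- The variable normal form: the `i`-th variable occurring in the body becomes the `i`-th
variable (both counted from `0`). -/
noncomputable def vnf (σ : SkRule S) : SkRule S := σ.rename (fun x => σ.bodyVarList.idxOf x)

end SkRule

/-- The term that replaces the variable `x` in the head conjunction `D` of `τ` under Skolemisation:
`x` itself if it is universally quantified, and otherwise its Skolem function applied to all
universally quantified variables. -/
def DisTGD.skolemTerm {S : Schema.{u}} (τ : DisTGD S) (D : Finset (Atom S ℕ)) (x : ℕ) : Term S :=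
  if x ∈ τ.bodyVars then Term.var x
  else Term.app ⟨τ, D, x⟩ (fun i => Term.var (τ.bodyVars.orderEmbOfFin rfl i))

open Classical in
/-- The Skolemisation of a single-headed DisTGD (every head conjunction is a singleton, so that the
union below is the set of disjuncts). -/
noncomputable def DisTGD.skolemise {S : Schema.{u}} (τ : DisTGD S) : SkRule S where
  body := τ.body.image (Atom.map Term.var)
  head := τ.head.biUnion (fun D => D.image (Atom.map (τ.skolemTerm D)))

open Classical in
/-- `δ` is a de-Skolemisation of the rule `σ` with function-free body: variables are kept, and
distinct functional terms of the head are replaced by distinct existentially quantified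
variables. -/
def IsDeSkolemisation {S : Schema.{u}} (σ : SkRule S) (δ : DisTGD S) : Prop :=
  ∃ g : Term S → ℕ,
    (∀ x, g (Term.var x) = x) ∧
    Set.InjOn g {t | t.IsFunctional ∧ ∃ A ∈ σ.head, ∃ i, A.args i = t} ∧
    (∀ A ∈ σ.head, ∀ i, (A.args i).IsFunctional → g (A.args i) ∉ σ.vars) ∧
    σ.body = δ.body.image (Atom.map Term.var) ∧
    δ.head = σ.head.image (fun A => {A.map g})

/-! ## The disjunctive guarded saturation -/

open Classical in
/-- The resolvent of `σ` and `σ'` on the head atom `H` and the body atom `B`, under `θ`. -/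
noncomputable def dResolvent {S : Schema.{u}} (σ σ' : SkRule S) (H B : Atom S (Term S))
    (θ : ℕ → Term S) : SkRule S :=
  SkRule.subst θ ⟨σ.body ∪ σ'.body.erase B, σ.head.erase H ∪ σ'.head⟩

/-- `κ` is inferred from `σ` and `σ'` by (D-EVOLVE); `σ'` is first renamed by `ρ` so that the two
rules use distinct variables. -/
def DEvolve {S : Schema.{u}} (σ σ' κ : SkRule S) : Prop :=
  ∃ (ρ : ℕ → ℕ) (H B : Atom S (Term S)) (θ : ℕ → Term S),
    Set.InjOn ρ σ'.vars ∧ Disjoint σ.vars (σ'.rename ρ).vars ∧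
    σ.IsNonFull ∧ H ∈ σ.head ∧ H.IsFunctional ∧
    B ∈ (σ'.rename ρ).body ∧
    (((σ'.rename ρ).IsFull ∧ (σ'.rename ρ).IsGuard B) ∨ B.IsFunctional) ∧
    Atom.IsMGU θ H B ∧
    κ = (dResolvent σ (σ'.rename ρ) H B θ).vnf

/-- The closure of `VNF(Sk(SHNF(Γ)))` under (D-EVOLVE). -/
inductive DGSatEx {S : Schema.{u}} (Γ : Set (DisTGD S)) : SkRule (shnfSchema Γ) → Prop
  | base (τ : DisTGD (shnfSchema Γ)) (hτ : τ ∈ SHNF Γ) : DGSatEx Γ τ.skolemise.vnf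
  | step (σ σ' κ : SkRule (shnfSchema Γ)) (h : DGSatEx Γ σ) (h' : DGSatEx Γ σ')
      (hκ : DEvolve σ σ' κ) : DGSatEx Γ κ

/-- The disjunctive guarded saturation: the immediate full consequences of (the DisTGDs
corresponding to) the rules in the closure. -/
def DGSat {S : Schema.{u}} (Γ : Set (DisTGD S)) : Set (DisTGD (shnfSchema Γ)) :=
  IFC {δ | ∃ σ, DGSatEx Γ σ ∧ IsDeSkolemisation σ δ}

/-! ## Tree-like disjunctive chase trees -/

/-- An instance decomposed into a tree of bags. The nodes of the tree are addresses: `[]` is the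
root, and the children of `p` are of the form `k :: p`. -/
structure TreeInst (S : Schema.{u}) (K : Type v) where
  nodes : Finset (List ℕ)
  bag : List ℕ → Set (Atom S K)

namespace TreeInst

variable {S : Schema.{u}} {K : Type v}

/-- The underlying set of facts. -/
def facts (I : TreeInst S K) : Set (Atom S K) := {F | ∃ p ∈ I.nodes, F ∈ I.bag p}

/-- The constants of the instance. -/
def consts (I : TreeInst S K) : Set K := {c | ∃ F ∈ I.facts, c ∈ F.consts}

/-- The instance `N` with a single node, the root. -/
def single (N : Set (Atom S K)) : TreeInst S K where
  nodes := {[]}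
  bag := fun p => {F | p = [] ∧ F ∈ N}

/-- Add the facts `X` to the bag of the node `p`. -/
def addFacts (I : TreeInst S K) (p : List ℕ) (X : Set (Atom S K)) : TreeInst S K where
  nodes := I.nodes
  bag := Function.update I.bag p (I.bag p ∪ X)

/-- Add a new node `q` with bag `X`. -/
def addNode (I : TreeInst S K) (q : List ℕ) (X : Set (Atom S K)) : TreeInst S K where
  nodes := insert q I.nodes
  bag := Function.update I.bag q X

/-- Propagate every fact to all nodes that contain a fact guarding it. -/
def propagate (I : TreeInst S K) : TreeInst S K where
  nodes := I.nodes
  bag := fun p => {F | F ∈ I.facts ∧ ∃ G ∈ I.bag p, F.consts ⊆ G.consts}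

end TreeInst

/-- A (disjunctive, oblivious, tree-like) chase step in `I`: a rule, the node in which it is
triggered, the trigger, for every head conjunction an extension of the trigger by distinct fresh
constants for the existential variables, and the address of a possible new child of the node. -/
structure ChaseStep {S : Schema.{u}} {K : Type v} (I : TreeInst S K) where
  rule : DisTGD S
  node : List ℕ
  node_mem : node ∈ I.nodes
  trigger : ℕ → K
  trigger_body : ∀ B ∈ rule.body, B.map trigger ∈ I.bag node
  ext : Finset (Atom S ℕ) → ℕ → K
  ext_eq : ∀ D ∈ rule.head, ∀ x ∈ rule.bodyVars, ext D x = trigger x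
  ext_fresh : ∀ D ∈ rule.head, ∀ y ∈ rule.exVars D, ext D y ∉ I.consts
  ext_inj : ∀ D ∈ rule.head, Set.InjOn (ext D) (rule.exVars D : Set ℕ)
  label : ℕ
  label_fresh : label :: node ∉ I.nodes

namespace ChaseStep

variable {S : Schema.{u}} {K : Type v} {I : TreeInst S K}

/-- The node created by the non-full head conjunctions. -/
def newNode (s : ChaseStep I) : List ℕ := s.label :: s.node

/-- The facts created for the head conjunction `D`. -/
def newFacts (s : ChaseStep I) (D : Finset (Atom S ℕ)) : Set (Atom S K) :=
  {F | ∃ A ∈ D, F = A.map (s.ext D)}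

/-- The instance created for the head conjunction `D`: a full conjunction adds its facts to the
node in which the rule is triggered, a non-full one creates a new child of that node; then facts
are propagated. -/
def child (s : ChaseStep I) (D : Finset (Atom S ℕ)) : TreeInst S K :=
  if s.rule.exVars D = ∅ then (I.addFacts s.node (s.newFacts D)).propagate
  else (I.addNode s.newNode (s.newFacts D)).propagate

end ChaseStep

/-- Finite tree-like chase trees with root `I`: a node is a leaf, or a chase step is applied to it
and it has one child for every head conjunction of the rule fired. -/
inductive ChaseTree {S : Schema.{u}} {K : Type v} : TreeInst S K → Type (max u v)
  | leaf (I : TreeInst S K) : ChaseTree I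
  | fire {I : TreeInst S K} (s : ChaseStep I)
      (sub : ∀ D, D ∈ s.rule.head → ChaseTree (s.child D)) : ChaseTree I

namespace ChaseTree

variable {S : Schema.{u}} {K : Type v}

/-- The leaves of a chase tree. -/
def leaves {I : TreeInst S K} : ChaseTree I → Set (TreeInst S K)
  | leaf I => {I}
  | fire s sub => {L | ∃ D, ∃ hD : D ∈ s.rule.head, L ∈ (sub D hD).leaves}

/-- Every chase step of the tree fires a rule `τ` in a node `p` with `P τ p`. -/
def EveryStep (P : DisTGD S → List ℕ → Prop) {I : TreeInst S K} : ChaseTree I → Prop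
  | leaf _ => True
  | fire s sub => P s.rule s.node ∧ ∀ D, ∀ hD : D ∈ s.rule.head, (sub D hD).EveryStep P

/-- The query of the chase tree: the union of the conjunctions of the facts in the root bag `r`
of the leaves. -/
def query {I : TreeInst S K} (T : ChaseTree I) : Set (Set (Atom S K)) :=
  {Q | ∃ L ∈ T.leaves, Q = L.bag []}

/-- The chase tree models a union of conjunctions of facts: every leaf satisfies a disjunct. -/
def Models {I : TreeInst S K} (T : ChaseTree I) (Q : Set (Set (Atom S K))) : Prop :=
  ∀ L ∈ T.leaves, ∃ q ∈ Q, q ⊆ L.facts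

end ChaseTree

/-! ## Evolve-completeness -/

/-- `Γ'`, a set of full DisTGDs, is evolve-complete with respect to `Γ` (over the constants `K`). -/
structure EvolveComplete {S : Schema.{u}} (K : Type v) (Γ Γ' : Set (DisTGD S)) : Prop where
  /-- All rules of `Γ'` are full. -/
  full : ∀ τ ∈ Γ', τ.IsFull
  /-- The immediate full consequences of `Γ` are in `Γ'`, modulo renaming. -/
  ifc_mem : ∀ τ ∈ IFC Γ, ∃ τ' ∈ Γ', τ.IsVariant τ'
  /-- Suppose that the first step `s` of a chase tree with root `N` (with the single node `r = []`)
  fires a non-full rule of `Γ`, that below each child given by a non-full head conjunction only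
  full rules of `Γ'` are fired, in the new node only, and that the children given by full head
  conjunctions are leaves. Then some chase tree from `N` and `Γ'` models the query of the given
  tree. -/
  evolve : ∀ (N : Set (Atom S K)) (s : ChaseStep (TreeInst.single N))
    (sub : ∀ D, D ∈ s.rule.head → ChaseTree (s.child D)),
    s.rule ∈ Γ → ¬ s.rule.IsFull →
    (∀ D, ∀ hD : D ∈ s.rule.head, s.rule.exVars D ≠ ∅ →
      (sub D hD).EveryStep (fun τ p => τ ∈ Γ' ∧ τ.IsFull ∧ p = s.newNode)) →
    (∀ D, ∀ hD : D ∈ s.rule.head, s.rule.exVars D = ∅ → sub D hD = ChaseTree.leaf _) →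
    ∃ T' : ChaseTree (TreeInst.single N),
      T'.EveryStep (fun τ _ => τ ∈ Γ') ∧ T'.Models (ChaseTree.fire s sub).query

/-! The evolve condition is a completeness statement for (D-EVOLVE), proved by contradiction. If no
chase tree of full rules from N models the query, then compactness (`Derives.exists_finite`) and
Zorn's lemma (`exists_model_of_not_derives`) give a set M ⊇ N over the constants of N that is closed
under `DGSat Γ` and contains no disjunct of the query. It remains to find a branch of the given tree
whose root bag stays inside M.

To choose the branch, constants of the trigger are coded as variables and fresh constants as Skolem
terms, so that the first chase step becomes an instance of a rule of the closure. Call an instance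
of such a rule positive if its body lies in the coded M and its head avoids it. A positive instance
has a functional head atom, since M is closed under full rules. Let X be a minimal set meeting the
functional heads of all positive instances. The central fact, `exists_head_mem_of_full`, is that M ∪
X satisfies all full rules of the closure. The fired rule gives a positive instance, so X selects
one of its non-full disjuncts. Below that child, always following a disjunct that holds in M ∪ X
keeps the root bag in M, because atoms of X contain fresh constants and so are never propagated to
the root (`ChaseTree.exists_leaf_bag_subset`).

For the central fact, let a full rule τ fail in M ∪ X and let 𝒜 be the set of its body facts in X.
Its guard fact is in 𝒜. Minimality of X gives, for each A in 𝒜, a positive instance meeting X in A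
only; resolving these with τ ought to give a positive instance that misses X. The obstacle is that
(D-EVOLVE) removes one head atom and does not factor: another head atom with the same instance may
survive. The number of variables controls this. It never grows in the resolutions used, and when it
is minimal the unifiers are injective on the variables of the positive premise, which forces head
atoms with the same instance to coincide (`SemiInst.head_unique`). A second minimal hitting set Y ⊆
𝒜, for positive instances with the least number of variables, then permits a descent on the number
of head atoms over Y.

The syntactic basis is the invariant `SkRule.Regular`: rules are weakly guarded and all their Skolem
terms have one common list of variables as arguments. Unification preserves it
(`SkRule.Regular.dResolvent`), and ground resolution steps lift to the closure (`exists_resolves`).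
-/

/-! ## Terms: substitution, size, variables -/

namespace Term

variable {S : Schema.{u}}

/-- The number of symbols of a term. -/
def size : Term S → ℕ
  | var _ => 1
  | app _ ts => 1 + ∑ i, (ts i).size

theorem size_pos (t : Term S) : 0 < t.size := by
  cases t <;> simp [size]

theorem size_lt_app {f : SkolemSym S} {ts : Fin f.arity → Term S} {t : Term S}
    (h : t ∈ List.ofFn ts) : t.size < (app f ts).size := by
  obtain ⟨i, rfl⟩ := (List.mem_ofFn' ts t).1 h
  have := Finset.single_le_sum (f := fun i => (ts i).size) (fun _ _ => Nat.zero_le _)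
    (Finset.mem_univ i)
  simp only [size]
  omega

theorem mem_varList_var {x y : ℕ} : x ∈ (var y : Term S).varList ↔ x = y := by
  simp [varList]

theorem mem_varList_app {x : ℕ} {f : SkolemSym S} {ts : Fin f.arity → Term S} :
    x ∈ (app f ts).varList ↔ ∃ i, x ∈ (ts i).varList := by
  simp [varList, List.mem_flatten, List.mem_ofFn']

theorem mem_varList_subst {θ : ℕ → Term S} {t : Term S} {x : ℕ} :
    x ∈ (t.subst θ).varList ↔ ∃ y ∈ t.varList, x ∈ (θ y).varList := by
  induction t with
  | var y => simp [subst, varList]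
  | app f ts ih =>
    simp only [subst, mem_varList_app, ih]
    constructor
    · rintro ⟨i, y, hy, hx⟩
      exact ⟨y, ⟨i, hy⟩, hx⟩
    · rintro ⟨y, ⟨i, hy⟩, hx⟩
      exact ⟨i, y, hy, hx⟩

theorem subst_congr {θ θ' : ℕ → Term S} {t : Term S} (h : ∀ x ∈ t.varList, θ x = θ' x) :
    t.subst θ = t.subst θ' := by
  induction t with
  | var y => exact h y (by simp [varList])
  | app f ts ih =>
    simp only [subst, app.injEq, heq_eq_eq, true_and]
    funext i
    exact ih i fun x hx => h x (mem_varList_app.2 ⟨i, hx⟩)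

theorem subst_subst (θ δ : ℕ → Term S) (t : Term S) :
    (t.subst θ).subst δ = t.subst (fun x => (θ x).subst δ) := by
  induction t with
  | var y => rfl
  | app f ts ih => simp only [subst, ih]

theorem subst_var (t : Term S) : t.subst var = t := by
  induction t with
  | var y => rfl
  | app f ts ih => simp only [subst, ih]

theorem size_le_of_mem_varList {g : ℕ → Term S} {t : Term S} {x : ℕ} (h : x ∈ t.varList) :
    (g x).size ≤ (t.subst g).size := by
  induction t with
  | var y => rw [mem_varList_var.1 h]; rfl
  | app f ts ih =>
    obtain ⟨i, hi⟩ := mem_varList_app.1 h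
    exact (ih i hi).trans (size_lt_app (f := f) (ts := fun i => (ts i).subst g)
      ((List.mem_ofFn' _ _).2 ⟨i, rfl⟩)).le

/-- The occurs check: a proper subterm `x` of `t` would make `g x` strictly smaller than `t.subst
g`. -/
theorem not_mem_varList_of_unifies {g : ℕ → Term S} {x : ℕ} {t : Term S} (ht : t ≠ var x)
    (hg : g x = t.subst g) : x ∉ t.varList := by
  intro hx
  cases t with
  | var y => exact ht (by rw [mem_varList_var.1 hx])
  | app f ts =>
    obtain ⟨i, hi⟩ := mem_varList_app.1 hx
    have h1 := size_le_of_mem_varList (g := g) hi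
    have h2 : ((ts i).subst g).size < ((app f ts).subst g).size :=
      size_lt_app (f := f) (ts := fun i => (ts i).subst g) ((List.mem_ofFn' _ _).2 ⟨i, rfl⟩)
    rw [← hg] at h2
    omega

theorem isFunctional_app (f : SkolemSym S) (ts : Fin f.arity → Term S) :
    (app f ts).IsFunctional := fun _ h => by cases h

theorem not_isFunctional_var (x : ℕ) : ¬ (var x : Term S).IsFunctional := fun h => h x rfl

theorem isFunctional_iff {t : Term S} : t.IsFunctional ↔ ∃ f ts, t = app f ts := by
  cases t with
  | var x => simp [not_isFunctional_var]
  | app f ts => simp [isFunctional_app]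

theorem not_isFunctional_iff {t : Term S} : ¬ t.IsFunctional ↔ ∃ x, t = var x := by
  simp [IsFunctional]

theorem eq_var_of_subst_eq_var {t : Term S} {g : ℕ → Term S} {y : ℕ} (h : t.subst g = var y) :
    ∃ x, t = var x ∧ g x = var y := by
  cases t with
  | var x => exact ⟨x, rfl, h⟩
  | app f ts => cases h

theorem app_inj_ofFn {f f' : SkolemSym S} {ts : Fin f.arity → Term S} {ts' : Fin f'.arity → Term S}
    (h : app f ts = app f' ts') : f = f' ∧ List.ofFn ts = List.ofFn ts' := by
  cases h
  exact ⟨rfl, rfl⟩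

theorem app_eq_of_ofFn {f : SkolemSym S} {ts ts' : Fin f.arity → Term S}
    (h : List.ofFn ts = List.ofFn ts') : app f ts = app f ts' := by
  rw [List.ofFn_injective h]

theorem ofFn_subst {n : ℕ} (ts : Fin n → Term S) (g : ℕ → Term S) :
    List.ofFn (fun i => (ts i).subst g) = (List.ofFn ts).map (subst g) := by
  rw [List.map_ofFn]
  rfl

/-! ## Most general unifiers -/

/-- `θ` unifies all pairs of terms in `E`. -/
def Unifies (θ : ℕ → Term S) (E : List (Term S × Term S)) : Prop :=
  ∀ p ∈ E, p.1.subst θ = p.2.subst θ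

theorem unifies_cons {θ : ℕ → Term S} {p : Term S × Term S} {E : List (Term S × Term S)} :
    Unifies θ (p :: E) ↔ p.1.subst θ = p.2.subst θ ∧ Unifies θ E := by
  simp [Unifies]

/-- A unifiable list of pairs has a unifier `θ` such that `ρ = θρ` for all unifiers `ρ`. -/
def HasMGU (E : List (Term S × Term S)) : Prop :=
  ∃ θ, Unifies θ E ∧ ∀ ρ, Unifies ρ E → ∀ x, (θ x).subst ρ = ρ x

/-- Every unifier of `x` and `t` absorbs the substitution of `t` for `x`, so this substitution
composed with a most general unifier of the remaining pairs is most general. -/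
theorem HasMGU.elim_var {E : List (Term S × Term S)} {x : ℕ} {t : Term S} (hx : x ∉ t.varList)
    (h : HasMGU (E.map fun p => (p.1.subst (Function.update var x t),
      p.2.subst (Function.update var x t)))) : HasMGU ((var x, t) :: E) := by
  obtain ⟨θ, hθ, hm⟩ := h
  set τ : ℕ → Term S := Function.update var x t with hτ
  have hτx : τ x = t := by simp [hτ]
  have hτt : t.subst τ = t := by
    conv_rhs => rw [← subst_var t]
    apply subst_congr
    intro y hy
    have : y ≠ x := fun e => hx (e ▸ hy)
    simp [hτ, this]
  have key : ∀ ρ : ℕ → Term S, ρ x = t.subst ρ → ∀ y, (τ y).subst ρ = ρ y := by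
    intro ρ hρ y
    by_cases hy : y = x
    · rw [hy, hτx, hρ]
    · simp [hτ, hy, subst]
  refine ⟨fun y => (τ y).subst θ, ?_, ?_⟩
  · rw [unifies_cons]
    constructor
    · show (τ x).subst θ = _
      rw [← subst_subst, hτx, hτt]
    · intro p hp
      rw [← subst_subst, ← subst_subst]
      exact hθ _ (List.mem_map_of_mem hp)
  · intro ρ hρ y
    obtain ⟨h1, h2⟩ := unifies_cons.1 hρ
    have hk := key ρ h1
    have h3 : Unifies ρ (E.map fun p => (p.1.subst τ, p.2.subst τ)) := by
      intro q hq
      obtain ⟨p, hp, rfl⟩ := List.mem_map.1 hq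
      simp only [subst_subst, hk]
      exact h2 p hp
    rw [subst_subst]
    simp only [hm ρ h3, hk]

/-- The known unifier `g` provides the termination measure. Eliminating a variable leaves the
`g`-instances of the other pairs unchanged and drops one pair; decomposing two applications drops a
function symbol. -/
theorem hasMGU_of_unifies (g : ℕ → Term S) : ∀ (n : ℕ) (E : List (Term S × Term S)),
    (E.map fun p => (p.1.subst g).size).sum ≤ n → Unifies g E → HasMGU E := by
  intro n
  induction n with
  | zero =>
    intro E hn hg
    cases E with
    | nil => exact ⟨var, by simp [Unifies], fun ρ _ x => rfl⟩
    | cons p E =>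
      have := size_pos (p.1.subst g)
      simp at hn
      omega
  | succ n ih =>
    intro E hn hg
    have elim : ∀ (x : ℕ) (t : Term S) (E : List (Term S × Term S)), g x = t.subst g →
        Unifies g E → (E.map fun p => (p.1.subst g).size).sum ≤ n →
        HasMGU ((var x, t) :: E) := by
      intro x t E hx hE hn
      by_cases ht : t = var x
      · obtain ⟨θ, h1, h2⟩ := ih E hn hE
        refine ⟨θ, unifies_cons.2 ⟨by rw [ht], h1⟩, fun ρ hρ => h2 ρ (unifies_cons.1 hρ).2⟩
      · have hk : ∀ y, (Function.update var x t y).subst g = g y := by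
          intro y
          by_cases hy : y = x
          · rw [hy]; simp [hx]
          · simp [hy, subst]
        refine HasMGU.elim_var (not_mem_varList_of_unifies ht hx) (ih _ ?_ ?_)
        · simpa [List.map_map, Function.comp_def, subst_subst, hk] using hn
        · intro q hq
          obtain ⟨p, hp, rfl⟩ := List.mem_map.1 hq
          simp only [subst_subst, hk]
          exact hE p hp
    cases E with
    | nil => exact ⟨var, by simp [Unifies], fun ρ _ x => rfl⟩
    | cons p E =>
      obtain ⟨s, t⟩ := p
      obtain ⟨h1, h2⟩ := unifies_cons.1 hg
      have hpos := size_pos (s.subst g)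
      simp only [List.map_cons, List.sum_cons] at hn
      cases s with
      | var x => exact elim x t E h1 h2 (by omega)
      | app f ts =>
        cases t with
        | var y =>
          obtain ⟨θ, h3, h4⟩ := elim y (app f ts) E h1.symm h2 (by omega)
          have hsw : ∀ ρ : ℕ → Term S, Unifies ρ ((var y, app f ts) :: E) ↔
              Unifies ρ ((app f ts, var y) :: E) := by
            intro ρ
            rw [unifies_cons, unifies_cons]
            exact and_congr_left' eq_comm
          exact ⟨θ, (hsw θ).1 h3, fun ρ hρ => h4 ρ ((hsw ρ).2 hρ)⟩
        | app f' ts' =>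
          obtain ⟨rfl, -⟩ := app_inj_ofFn h1
          have hdec : ∀ ρ : ℕ → Term S, Unifies ρ ((app f ts, app f ts') :: E) ↔
              Unifies ρ (List.ofFn (fun i => (ts i, ts' i)) ++ E) := by
            intro ρ
            simp [Unifies, List.mem_ofFn', or_imp, forall_and, subst, funext_iff]
          have hs : (List.map (fun p : Term S × Term S => (p.1.subst g).size)
              (List.ofFn (fun i => (ts i, ts' i)) ++ E)).sum ≤ n := by
            simp only [List.map_append, List.map_ofFn, List.sum_append, List.sum_ofFn,
              Function.comp_def]
            simp only [subst, size] at hn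
            omega
          obtain ⟨θ, h3, h4⟩ := ih _ hs ((hdec g).1 hg)
          exact ⟨θ, (hdec θ).2 h3, fun ρ hρ => h4 ρ ((hdec ρ).1 hρ)⟩

open Classical in
/-- Replace all maximal functional subterms outside `T` by a variable. -/
noncomputable def collapse (T : Set (Term S)) : Term S → Term S
  | var x => var x
  | app f ts => if app f ts ∈ T then app f (fun i => (ts i).collapse T) else var 0

end Term

/-! ### Unification of atoms -/

namespace Atom

variable {S : Schema.{u}}

theorem mem_varList {A : Atom S (Term S)} {x : ℕ} :
    x ∈ A.varList ↔ ∃ i, x ∈ (A.args i).varList := by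
  simp [varList, List.mem_flatten, List.mem_ofFn']

theorem mem_varList_subst {θ : ℕ → Term S} {A : Atom S (Term S)} {x : ℕ} :
    x ∈ (A.subst θ).varList ↔ ∃ y ∈ A.varList, x ∈ (θ y).varList := by
  constructor
  · intro h
    obtain ⟨i, hi⟩ := mem_varList.1 h
    obtain ⟨y, hy, hx⟩ := Term.mem_varList_subst.1 hi
    exact ⟨y, mem_varList.2 ⟨i, hy⟩, hx⟩
  · rintro ⟨y, hy, hx⟩
    obtain ⟨i, hi⟩ := mem_varList.1 hy
    exact mem_varList.2 ⟨i, Term.mem_varList_subst.2 ⟨y, hi, hx⟩⟩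

theorem subst_congr {θ θ' : ℕ → Term S} {A : Atom S (Term S)} (h : ∀ x ∈ A.varList, θ x = θ' x) :
    A.subst θ = A.subst θ' := by
  obtain ⟨r, a⟩ := A
  simp only [subst, map, mk.injEq, heq_eq_eq, true_and]
  funext i
  exact Term.subst_congr fun x hx => h x (mem_varList.2 ⟨i, hx⟩)

theorem subst_subst (θ δ : ℕ → Term S) (A : Atom S (Term S)) :
    (A.subst θ).subst δ = A.subst (fun x => (θ x).subst δ) := by
  obtain ⟨r, a⟩ := A
  simp only [subst, map, mk.injEq, heq_eq_eq, true_and]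
  funext i
  exact Term.subst_subst θ δ (a i)

theorem exists_eq_of_subst_eq {θ θ' : ℕ → Term S} {A B : Atom S (Term S)}
    (h : A.subst θ = B.subst θ') : ∃ (r : S.Rel) (a b : Fin (S.arity r) → Term S),
      A = ⟨r, a⟩ ∧ B = ⟨r, b⟩ ∧ ∀ i, (a i).subst θ = (b i).subst θ' := by
  obtain ⟨r, a⟩ := A
  obtain ⟨r', b⟩ := B
  simp only [subst, map, mk.injEq] at h
  obtain ⟨rfl, h⟩ := h
  exact ⟨r, a, b, rfl, rfl, fun i => congrFun (eq_of_heq h) i⟩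

theorem subst_mk_eq_iff {θ θ' : ℕ → Term S} {r : S.Rel} {a b : Fin (S.arity r) → Term S} :
    (mk r a).subst θ = (mk r b).subst θ' ↔ ∀ i, (a i).subst θ = (b i).subst θ' := by
  simp [subst, map, funext_iff]

theorem exists_isMGU {A B : Atom S (Term S)} {g : ℕ → Term S} (h : IsUnifier g A B) :
    ∃ θ, IsMGU θ A B := by
  obtain ⟨r, a, b, rfl, rfl, hab⟩ := exists_eq_of_subst_eq h
  have key : ∀ ρ : ℕ → Term S, IsUnifier ρ (mk r a) (mk r b) ↔
      Term.Unifies ρ (List.ofFn fun i => (a i, b i)) := by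
    intro ρ
    rw [IsUnifier, subst_mk_eq_iff]
    simp [Term.Unifies, List.mem_ofFn']
  obtain ⟨θ, h1, h2⟩ := Term.hasMGU_of_unifies g _ _ le_rfl ((key g).1 h)
  exact ⟨θ, (key θ).2 h1, fun ρ hρ => ⟨ρ, fun x => (h2 ρ ((key ρ).1 hρ) x).symm⟩⟩

/-- The functional terms in the range of a most general unifier of two atoms of depth at most one
are instances of functional arguments of the two atoms. -/
theorem IsMGU.eq_subst_of_eq_app {r : S.Rel} {a b : Fin (S.arity r) → Term S} {θ : ℕ → Term S}
    (h : IsMGU θ ⟨r, a⟩ ⟨r, b⟩)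
    (ha : ∀ i f ts, a i = Term.app f ts → ∀ j, ∃ x, ts j = Term.var x)
    (hb : ∀ i f ts, b i = Term.app f ts → ∀ j, ∃ x, ts j = Term.var x)
    {x : ℕ} {f : SkolemSym S} {ts : Fin f.arity → Term S} (hx : θ x = Term.app f ts) :
    ∃ i, (∃ f' ts', a i = Term.app f' ts' ∧ Term.app f ts = (Term.app f' ts').subst θ) ∨
      (∃ f' ts', b i = Term.app f' ts' ∧ Term.app f ts = (Term.app f' ts').subst θ) := by
  by_contra hcon
  push Not at hcon
  -- If `θ x` is functional but not in `T`, collapsing it to a variable still unifies the atoms, as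
  -- their functional arguments have depth one. The collapsed unifier is then not an instance of
  -- `θ`.
  set T : Set (Term S) := {t | ∃ i, t = (a i).subst θ ∧ (a i).IsFunctional ∨
    t = (b i).subst θ ∧ (b i).IsFunctional} with hT
  have key : ∀ t : Term S, (∀ f ts, t = Term.app f ts → ∀ j, ∃ x, ts j = Term.var x) →
      (t.IsFunctional → t.subst θ ∈ T) →
      t.subst (fun x => (θ x).collapse T) = (t.subst θ).collapse T := by
    intro t h1 h2
    cases t with
    | var x => rfl
    | app f ts =>
      have h3 : Term.app f (fun i => (ts i).subst θ) ∈ T := h2 (Term.isFunctional_app f ts)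
      simp only [Term.subst, Term.collapse, if_pos h3, Term.app.injEq, heq_eq_eq, true_and]
      funext j
      obtain ⟨x, hx⟩ := h1 f ts rfl j
      rw [hx]
      rfl
  have hu : IsUnifier (fun x => (θ x).collapse T) (mk r a) (mk r b) := by
    refine subst_mk_eq_iff.2 fun i => ?_
    rw [key _ (ha i) (fun hf => ⟨i, Or.inl ⟨rfl, hf⟩⟩), key _ (hb i) (fun hf => ⟨i, Or.inr ⟨rfl, hf⟩⟩),
      subst_mk_eq_iff.1 h.1 i]
  obtain ⟨δ, hδ⟩ := h.2 _ hu
  have h1 := hδ x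
  have h2 : Term.app f ts ∉ T := by
    rintro ⟨i, ⟨h3, h4⟩ | ⟨h3, h4⟩⟩
    · obtain ⟨f', ts', h5⟩ := Term.isFunctional_iff.1 h4
      exact (hcon i).1 f' ts' h5 (by rw [h3, h5])
    · obtain ⟨f', ts', h5⟩ := Term.isFunctional_iff.1 h4
      exact (hcon i).2 f' ts' h5 (by rw [h3, h5])
  rw [hx] at h1
  simp only [Term.collapse, if_neg h2, Term.subst] at h1
  cases h1

end Atom

/-! ## Rules with Skolem terms -/

namespace SkRule

variable {S : Schema.{u}}

theorem mem_vars_of_mem_body {σ : SkRule S} {A : Atom S (Term S)} (hA : A ∈ σ.body) {x : ℕ}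
    (hx : x ∈ A.varList) : x ∈ σ.vars := ⟨A, Or.inl hA, hx⟩

theorem mem_vars_of_mem_head {σ : SkRule S} {A : Atom S (Term S)} (hA : A ∈ σ.head) {x : ℕ}
    (hx : x ∈ A.varList) : x ∈ σ.vars := ⟨A, Or.inr hA, hx⟩

theorem mem_subst_iff {θ : ℕ → Term S} {σ : SkRule S} {A : Atom S (Term S)} :
    (A ∈ (σ.subst θ).body ∨ A ∈ (σ.subst θ).head) ↔
      ∃ A', (A' ∈ σ.body ∨ A' ∈ σ.head) ∧ A = A'.subst θ := by
  simp only [subst, Finset.mem_image]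
  constructor
  · rintro (⟨A', h, rfl⟩ | ⟨A', h, rfl⟩)
    · exact ⟨A', Or.inl h, rfl⟩
    · exact ⟨A', Or.inr h, rfl⟩
  · rintro ⟨A', h | h, rfl⟩
    · exact Or.inl ⟨A', h, rfl⟩
    · exact Or.inr ⟨A', h, rfl⟩

theorem mem_vars_subst {θ : ℕ → Term S} {σ : SkRule S} {x : ℕ} :
    x ∈ (σ.subst θ).vars ↔ ∃ y ∈ σ.vars, x ∈ (θ y).varList := by
  constructor
  · rintro ⟨A, hA, hx⟩
    obtain ⟨A', hA', rfl⟩ := mem_subst_iff.1 hA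
    obtain ⟨y, hy, hxy⟩ := Atom.mem_varList_subst.1 hx
    exact ⟨y, ⟨A', hA', hy⟩, hxy⟩
  · rintro ⟨y, ⟨A', hA', hy⟩, hxy⟩
    exact ⟨A'.subst θ, mem_subst_iff.2 ⟨A', hA', rfl⟩, Atom.mem_varList_subst.2 ⟨y, hy, hxy⟩⟩

theorem finite_vars (σ : SkRule S) : σ.vars.Finite := by
  classical
  refine ((σ.body ∪ σ.head).biUnion fun A => A.varList.toFinset).finite_toSet.subset ?_
  rintro x ⟨A, hA, hx⟩
  simp only [Finset.coe_biUnion, Set.mem_iUnion, Finset.mem_coe, List.mem_toFinset]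
  exact ⟨A, Finset.mem_union.2 hA, hx⟩

/-- The rule is weakly guarded: some body atom contains all variables, and all functional arguments
have the same list of arguments, which consists of all the variables of the rule. -/
structure Regular (σ : SkRule S) : Prop where
  head_nonempty : σ.head.Nonempty
  guard : ∃ G ∈ σ.body, ∀ x ∈ σ.vars, x ∈ G.varList
  args : ∃ ℓ : List ℕ, ∀ A, (A ∈ σ.body ∨ A ∈ σ.head) → ∀ i f ts, A.args i = Term.app f ts →
    List.ofFn ts = ℓ.map Term.var ∧ ∀ x ∈ σ.vars, x ∈ ℓ

theorem Regular.rename {σ : SkRule S} (h : σ.Regular) (ρ : ℕ → ℕ) : (σ.rename ρ).Regular := by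
  classical
  obtain ⟨h1, ⟨G, hG, hGv⟩, ℓ, hℓ⟩ := h
  refine ⟨h1.image _, ⟨G.subst _, Finset.mem_image_of_mem _ hG, ?_⟩, ℓ.map ρ, ?_⟩
  · intro x hx
    obtain ⟨y, hy, hxy⟩ := mem_vars_subst.1 hx
    exact Atom.mem_varList_subst.2 ⟨y, hGv y hy, hxy⟩
  · intro A hA i f ts hts
    obtain ⟨A', hA', rfl⟩ := mem_subst_iff.1 hA
    change (A'.args i).subst _ = _ at hts
    cases hA'i : A'.args i with
    | var x => rw [hA'i] at hts; cases hts
    | app f' ts' =>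
      rw [hA'i] at hts
      obtain ⟨h2, h3⟩ := hℓ A' hA' i f' ts' hA'i
      cases hts
      refine ⟨?_, ?_⟩
      · rw [Term.ofFn_subst, h2]
        simp [List.map_map, Function.comp_def, Term.subst]
      · intro x hx
        obtain ⟨y, hy, hxy⟩ := mem_vars_subst.1 hx
        rw [Term.mem_varList_var.1 hxy]
        exact List.mem_map_of_mem (h3 y hy)

theorem Regular.args_var {σ : SkRule S} (h : σ.Regular) {A : Atom S (Term S)}
    (hA : A ∈ σ.body ∨ A ∈ σ.head) {i : Fin (S.arity A.rel)} {f : SkolemSym S}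
    {ts : Fin f.arity → Term S} (hts : A.args i = Term.app f ts) (j : Fin f.arity) :
    ∃ x, ts j = Term.var x := by
  obtain ⟨ℓ, hℓ⟩ := h.args
  have h1 : ts j ∈ List.ofFn ts := (List.mem_ofFn' _ _).2 ⟨j, rfl⟩
  rw [(hℓ A hA i f ts hts).1] at h1
  obtain ⟨x, -, hx⟩ := List.mem_map.1 h1
  exact ⟨x, hx.symm⟩

/-- A functional atom of a regular rule contains all its variables. -/
theorem Regular.mem_varList {σ : SkRule S} (h : σ.Regular) {A : Atom S (Term S)}
    (hA : A ∈ σ.body ∨ A ∈ σ.head) (hf : A.IsFunctional) {x : ℕ} (hx : x ∈ σ.vars) :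
    x ∈ A.varList := by
  obtain ⟨ℓ, hℓ⟩ := h.args
  obtain ⟨i, hi⟩ := hf
  obtain ⟨f, ts, hts⟩ := Term.isFunctional_iff.1 hi
  obtain ⟨h1, h2⟩ := hℓ A hA i f ts hts
  refine Atom.mem_varList.2 ⟨i, ?_⟩
  rw [hts, Term.mem_varList_app]
  have h3 : (Term.var x : Term S) ∈ List.ofFn ts := by
    rw [h1]
    exact List.mem_map_of_mem (h2 x hx)
  obtain ⟨j, hj⟩ := (List.mem_ofFn' _ _).1 h3
  exact ⟨j, by rw [hj]; exact Term.mem_varList_var.2 rfl⟩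

/-- The unifier identifies the argument lists of the two rules whenever both have Skolem terms, and
maps the list of `σ` to variables: otherwise a term would be a proper subterm of itself. The image
of this list serves the resolvent. The guard of `σ` remains a guard because `H` and `B` contain all
variables of their rules. -/
theorem Regular.dResolvent {σ σ' : SkRule S} (h : σ.Regular) (h' : σ'.Regular)
    {H B : Atom S (Term S)} (hH : H ∈ σ.head) (hHf : H.IsFunctional) (hB : B ∈ σ'.body)
    (hBv : ∀ x ∈ σ'.vars, x ∈ B.varList)
    (hBf : ∀ A, (A ∈ σ'.body ∨ A ∈ σ'.head) → A.IsFunctional → B.IsFunctional)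
    {θ : ℕ → Term S} (hθ : Atom.IsMGU θ H B) :
    (dResolvent σ σ' H B θ).Regular ∧
      ∀ x ∈ (dResolvent σ σ' H B θ).vars, x ∈ (H.subst θ).varList := by
  classical
  have hmem : ∀ A, (A ∈ (_root_.dResolvent σ σ' H B θ).body ∨
      A ∈ (_root_.dResolvent σ σ' H B θ).head) →
      ∃ A', ((A' ∈ σ.body ∨ A' ∈ σ.head) ∨ (A' ∈ σ'.body ∨ A' ∈ σ'.head)) ∧ A = A'.subst θ := by
    intro A hA
    obtain ⟨A', hA', rfl⟩ := mem_subst_iff.1 hA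
    refine ⟨A', ?_, rfl⟩
    simp only [Finset.mem_union, Finset.mem_erase] at hA'
    tauto
  have hvars : ∀ x ∈ (_root_.dResolvent σ σ' H B θ).vars, x ∈ (H.subst θ).varList := by
    rintro x ⟨A, hA, hx⟩
    obtain ⟨A', hA', rfl⟩ := hmem A hA
    obtain ⟨y, hy, hxy⟩ := Atom.mem_varList_subst.1 hx
    rcases hA' with hA' | hA'
    · exact Atom.mem_varList_subst.2 ⟨y, h.mem_varList (Or.inr hH) hHf ⟨A', hA', hy⟩, hxy⟩
    · rw [show H.subst θ = B.subst θ from hθ.1]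
      exact Atom.mem_varList_subst.2 ⟨y, hBv y ⟨A', hA', hy⟩, hxy⟩
  have hHvars : ∀ x ∈ (H.subst θ).varList, ∃ y ∈ σ.vars, x ∈ (θ y).varList := by
    intro x hx
    obtain ⟨y, hy, hxy⟩ := Atom.mem_varList_subst.1 hx
    exact ⟨y, mem_vars_of_mem_head hH hy, hxy⟩
  refine ⟨⟨?_, ?_, ?_⟩, hvars⟩
  · exact (h'.head_nonempty.mono Finset.subset_union_right).image _
  · obtain ⟨G, hG, hGv⟩ := h.guard
    refine ⟨G.subst θ, Finset.mem_image_of_mem _ (Finset.mem_union_left _ hG), fun x hx => ?_⟩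
    obtain ⟨y, hy, hxy⟩ := hHvars x (hvars x hx)
    exact Atom.mem_varList_subst.2 ⟨y, hGv y hy, hxy⟩
  · obtain ⟨ℓ, hℓ⟩ := h.args
    obtain ⟨ℓ', hℓ'⟩ := h'.args
    have hHa : ∀ i f ts, H.args i = Term.app f ts → ∀ j, ∃ x, ts j = Term.var x :=
      fun i f ts hts => h.args_var (Or.inr hH) hts
    have hBa : ∀ i f ts, B.args i = Term.app f ts → ∀ j, ∃ x, ts j = Term.var x :=
      fun i f ts hts => h'.args_var (Or.inl hB) hts
    obtain ⟨r, a, b, rfl, rfl, hab⟩ := Atom.exists_eq_of_subst_eq hθ.1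
    obtain ⟨i₀, hi₀⟩ := hHf
    obtain ⟨f₀, ts₀, hts₀⟩ := Term.isFunctional_iff.1 hi₀
    change a i₀ = _ at hts₀
    obtain ⟨hℓ₀, hσℓ⟩ := hℓ _ (Or.inr hH) i₀ f₀ ts₀ hts₀
    have happ : ∀ {f : SkolemSym S} {ts : Fin f.arity → Term S} {m : List ℕ},
        List.ofFn ts = m.map Term.var →
        List.ofFn (fun j => (ts j).subst θ) = m.map θ := by
      intro f ts m hm
      rw [Term.ofFn_subst, hm, List.map_map]
      rfl
    -- the two argument lists are unified
    have hlists : (∃ A, (A ∈ σ'.body ∨ A ∈ σ'.head) ∧ A.IsFunctional) → ℓ'.map θ = ℓ.map θ := by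
      rintro ⟨A, hA, hAf⟩
      obtain ⟨j₀, hj₀⟩ := hBf A hA hAf
      obtain ⟨e₀, us₀, hus₀⟩ := Term.isFunctional_iff.1 hj₀
      change b j₀ = _ at hus₀
      obtain ⟨hℓ'₀, hσ'ℓ'⟩ := hℓ' _ (Or.inl hB) j₀ e₀ us₀ hus₀
      have h1 := hab i₀
      have h2 := hab j₀
      rw [hts₀] at h1
      rw [hus₀] at h2
      cases hb : b i₀ with
      | app f ts =>
        rw [hb] at h1
        rw [← happ hℓ₀, ← happ (hℓ' _ (Or.inl hB) i₀ f ts hb).1]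
        exact (Term.app_inj_ofFn h1).2.symm
      | var z =>
        cases ha : a j₀ with
        | app f ts =>
          rw [ha] at h2
          rw [← happ hℓ'₀, ← happ (hℓ _ (Or.inr hH) j₀ f ts ha).1]
          exact (Term.app_inj_ofFn h2).2.symm
        | var x =>
          -- Crossed positions: `θ z` is a Skolem term over `ℓ`, which contains `x`, and `θ x` is
          -- one over `ℓ'`, which contains `z`. Each would be smaller than the other.
          exfalso
          rw [hb] at h1
          rw [ha] at h2
          have hz : z ∈ ℓ' := hσ'ℓ' z (mem_vars_of_mem_body hB
            (Atom.mem_varList.2 ⟨i₀, by show z ∈ (b i₀).varList; rw [hb]; simp [Term.varList]⟩))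
          have hx : x ∈ ℓ := hσℓ x (mem_vars_of_mem_head hH
            (Atom.mem_varList.2 ⟨j₀, by show x ∈ (a j₀).varList; rw [ha]; simp [Term.varList]⟩))
          have h3 : (θ z).size < (θ x).size := by
            rw [show θ x = _ from h2]
            refine Term.size_lt_app ?_
            rw [happ hℓ'₀]
            exact List.mem_map_of_mem hz
          have h4 : (θ x).size < (θ z).size := by
            rw [show θ z = _ from h1.symm]
            refine Term.size_lt_app ?_
            rw [happ hℓ₀]
            exact List.mem_map_of_mem hx
          omega
    have hθapp : ∀ {y : ℕ} {f : SkolemSym S} {ts : Fin f.arity → Term S}, θ y = Term.app f ts →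
        List.ofFn ts = ℓ.map θ := by
      intro y f ts hy
      obtain ⟨i, ⟨f', ts', h1, h2⟩ | ⟨f', ts', h1, h2⟩⟩ := hθ.eq_subst_of_eq_app hHa hBa hy
      · rw [(Term.app_inj_ofFn h2).2]
        exact happ (hℓ _ (Or.inr hH) i f' ts' h1).1
      · rw [(Term.app_inj_ofFn h2).2, happ (hℓ' _ (Or.inl hB) i f' ts' h1).1]
        exact hlists ⟨_, Or.inl hB, i, by
          show (b i).IsFunctional; rw [h1]; exact Term.isFunctional_app _ _⟩
    have hvar : ∀ y ∈ ℓ, ∃ x, θ y = Term.var x := by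
      intro y hy
      cases hθy : θ y with
      | var x => exact ⟨x, rfl⟩
      | app f ts =>
        exfalso
        have h1 : θ y ∈ List.ofFn ts := by
          rw [hθapp hθy]
          exact List.mem_map_of_mem hy
        have h2 := Term.size_lt_app h1
        rw [hθy] at h2
        exact lt_irrefl _ h2
    choose! θ' hθ' using hvar
    have hmap : ℓ.map θ = (ℓ.map θ').map Term.var := by
      rw [List.map_map]
      exact List.map_congr_left hθ'
    refine ⟨ℓ.map θ', fun A hA i f ts hts => ⟨?_, ?_⟩⟩
    · rw [← hmap]
      obtain ⟨A', hA', rfl⟩ := hmem A hA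
      change (A'.args i).subst θ = _ at hts
      cases hA'i : A'.args i with
      | var y =>
        rw [hA'i] at hts
        exact hθapp hts
      | app f' ts' =>
        rw [hA'i] at hts
        rw [← (Term.app_inj_ofFn hts).2]
        rcases hA' with hA' | hA'
        · exact happ (hℓ A' hA' i f' ts' hA'i).1
        · rw [happ (hℓ' A' hA' i f' ts' hA'i).1]
          exact hlists ⟨A', hA', i, by rw [hA'i]; exact Term.isFunctional_app _ _⟩
    · intro x hx
      obtain ⟨y, hy, hxy⟩ := hHvars x (hvars x hx)
      have hyℓ := hσℓ y hy
      rw [hθ' y hyℓ, Term.mem_varList_var] at hxy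
      rw [hxy]
      exact List.mem_map_of_mem hyℓ

/-! ### The variable normal form of regular rules -/

theorem mem_bodyVarList {σ : SkRule S} {x : ℕ} :
    x ∈ σ.bodyVarList ↔ ∃ A ∈ σ.body, x ∈ A.varList := by
  simp [bodyVarList, List.mem_flatten]

theorem Regular.mem_bodyVarList {σ : SkRule S} (h : σ.Regular) {x : ℕ} (hx : x ∈ σ.vars) :
    x ∈ σ.bodyVarList := by
  obtain ⟨G, hG, hGv⟩ := h.guard
  exact SkRule.mem_bodyVarList.2 ⟨G, hG, hGv x hx⟩

theorem Regular.injOn_idxOf {σ : SkRule S} (h : σ.Regular) :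
    Set.InjOn (fun x => σ.bodyVarList.idxOf x) σ.vars := by
  intro x hx y _ hxy
  exact (List.idxOf_inj (h.mem_bodyVarList hx)).1 hxy

/-- A substitution of the variables of a regular rule factors through the variable normal form. -/
theorem Regular.exists_vnf_subst {σ : SkRule S} (h : σ.Regular) (g : ℕ → Term S) :
    ∃ g' : ℕ → Term S, ∀ x ∈ σ.vars, g' (σ.bodyVarList.idxOf x) = g x := by
  -- The default `0` is never used for variables of the rule, whose indices are within the list.
  refine ⟨fun k => g (σ.bodyVarList.getD k 0), fun x hx => ?_⟩
  have h1 := h.mem_bodyVarList hx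
  have h2 : σ.bodyVarList.idxOf x < σ.bodyVarList.length := List.idxOf_lt_length_iff.2 h1
  simp only [List.getD_eq_getElem _ _ h2, List.getElem_idxOf]

end SkRule

/-- The common argument list is the increasing enumeration of all body variables, to which
Skolemisation applies every function symbol. -/
theorem DisTGD.IsGuarded.regular_skolemise {S : Schema.{u}} {τ : DisTGD S} (hτ : τ.IsGuarded) :
    τ.skolemise.Regular ∧ ∀ x ∈ τ.skolemise.vars, x ∈ τ.bodyVars := by
  classical
  have hbody : ∀ A ∈ τ.skolemise.body, ∃ A' ∈ τ.body, A = A'.map Term.var := by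
    intro A hA
    obtain ⟨A', h, rfl⟩ := Finset.mem_image.1 hA
    exact ⟨A', h, rfl⟩
  have hhead : ∀ A ∈ τ.skolemise.head, ∃ D ∈ τ.head, ∃ A' ∈ D, A = A'.map (τ.skolemTerm D) := by
    intro A hA
    obtain ⟨D, hD, hA⟩ := Finset.mem_biUnion.1 hA
    obtain ⟨A', h, rfl⟩ := Finset.mem_image.1 hA
    exact ⟨D, hD, A', h, rfl⟩
  have hvars : ∀ x ∈ τ.skolemise.vars, x ∈ τ.bodyVars := by
    rintro x ⟨A, hA | hA, hx⟩
    · obtain ⟨A', hA', rfl⟩ := hbody A hA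
      obtain ⟨i, hi⟩ := Atom.mem_varList.1 hx
      rw [show x = A'.args i from Term.mem_varList_var.1 hi]
      exact Finset.mem_biUnion.2 ⟨A', hA', Finset.mem_image_of_mem _ (Finset.mem_univ _)⟩
    · obtain ⟨D, hD, A', hA', rfl⟩ := hhead A hA
      obtain ⟨i, hi⟩ := Atom.mem_varList.1 hx
      change x ∈ (τ.skolemTerm D (A'.args i)).varList at hi
      unfold DisTGD.skolemTerm at hi
      split_ifs at hi with h
      · rw [Term.mem_varList_var.1 hi]
        exact h
      · obtain ⟨j, hj⟩ := Term.mem_varList_app.1 hi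
        rw [Term.mem_varList_var.1 hj]
        exact Finset.orderEmbOfFin_mem _ _ _
  refine ⟨⟨?_, ?_, ?_⟩, hvars⟩
  · obtain ⟨D, hD⟩ := τ.head_nonempty
    obtain ⟨A, hA⟩ := τ.conj_nonempty D hD
    exact ⟨_, Finset.mem_biUnion.2 ⟨D, hD, Finset.mem_image_of_mem _ hA⟩⟩
  · obtain ⟨G, hG, hGv⟩ := hτ
    refine ⟨G.map Term.var, Finset.mem_image_of_mem _ hG, fun x hx => ?_⟩
    obtain ⟨i, -, hi⟩ := Finset.mem_image.1 (hGv (hvars x hx))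
    exact Atom.mem_varList.2 ⟨i, Term.mem_varList_var.2 hi.symm⟩
  · refine ⟨List.ofFn (τ.bodyVars.orderEmbOfFin rfl), ?_⟩
    rintro A (hA | hA) i f ts hts
    · obtain ⟨A', hA', rfl⟩ := hbody A hA
      cases hts
    · obtain ⟨D, hD, A', hA', rfl⟩ := hhead A hA
      change τ.skolemTerm D (A'.args i) = _ at hts
      unfold DisTGD.skolemTerm at hts
      split_ifs at hts with h
      cases hts
      refine ⟨by rw [List.map_ofFn]; rfl, fun x hx => ?_⟩
      have h2 : x ∈ Set.range (τ.bodyVars.orderEmbOfFin rfl) := by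
        rw [Finset.range_orderEmbOfFin]
        exact hvars x hx
      obtain ⟨j, hj⟩ := h2
      exact (List.mem_ofFn' _ _).2 ⟨j, hj⟩

/-! ## The rules of the saturation -/

section Saturation

variable {S : Schema.{u}} {Γ : Set (DisTGD S)}

theorem mem_conjVars {S : Schema.{u}} {D : Finset (Atom S ℕ)} {x : ℕ} :
    x ∈ conjVars D ↔ ∃ A ∈ D, ∃ i, A.args i = x := by
  simp [conjVars, Atom.vars]

theorem isGuarded_of_mem_SHNF (hΓ : ∀ τ ∈ Γ, τ.IsGuarded) {τ : DisTGD (shnfSchema Γ)}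
    (hτ : τ ∈ SHNF Γ) : τ.IsGuarded := by
  classical
  obtain ⟨τ', hτ', rfl | ⟨D, hD, A, hA, rfl⟩⟩ := hτ
  · obtain ⟨G, hG, hGv⟩ := hΓ τ' hτ'
    refine ⟨liftAtom G, Finset.mem_image_of_mem _ hG, fun x hx => ?_⟩
    obtain ⟨B, hB, i, hi⟩ := mem_conjVars.1 hx
    obtain ⟨B', hB', rfl⟩ := Finset.mem_image.1 hB
    exact hGv (mem_conjVars.2 ⟨B', hB', i, hi⟩)
  · refine ⟨_, Finset.mem_singleton_self _, fun x hx => ?_⟩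
    obtain ⟨B, hB, i, hi⟩ := mem_conjVars.1 hx
    cases Finset.mem_singleton.1 hB
    exact Finset.mem_image.2 ⟨i, Finset.mem_univ _, hi⟩

theorem exists_eq_singleton_of_mem_SHNF {τ : DisTGD (shnfSchema Γ)} (hτ : τ ∈ SHNF Γ)
    {D : Finset (Atom (shnfSchema Γ) ℕ)} (hD : D ∈ τ.head) : ∃ A, D = {A} := by
  classical
  obtain ⟨τ', hτ', rfl | ⟨D', hD', A, hA, rfl⟩⟩ := hτ
  · obtain ⟨D', -, rfl⟩ := Finset.mem_image.1 hD
    exact ⟨_, rfl⟩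
  · exact ⟨_, Finset.mem_singleton.1 hD⟩

/-- Reduces the two side conditions of (D-EVOLVE) to what `SkRule.Regular.dResolvent` needs: a full
rule has no functional atoms at all, and a functional atom of a regular rule contains all variables.
-/
theorem rename_guard_conditions {S : Schema.{u}} {σ : SkRule S} (h : σ.Regular)
    {B : Atom S (Term S)} (hB : B ∈ σ.body)
    (hg : (σ.IsFull ∧ σ.IsGuard B) ∨ B.IsFunctional) :
    (∀ x ∈ σ.vars, x ∈ B.varList) ∧
      ∀ A, (A ∈ σ.body ∨ A ∈ σ.head) → A.IsFunctional → B.IsFunctional := by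
  rcases hg with ⟨hf, hg⟩ | hg
  · refine ⟨hg.2, ?_⟩
    rintro A (hA | hA) hAf
    · exact absurd hAf (hf.1 A hA)
    · exact absurd hAf (hf.2 A hA)
  · exact ⟨fun x hx => h.mem_varList (Or.inl hB) hg hx, fun _ _ _ => hg⟩

theorem DGSatEx.regular (hΓ : ∀ τ ∈ Γ, τ.IsGuarded) {σ : SkRule (shnfSchema Γ)}
    (h : DGSatEx Γ σ) : σ.Regular := by
  induction h with
  | base τ hτ => exact (isGuarded_of_mem_SHNF hΓ hτ).regular_skolemise.1.rename _
  | step σ σ' κ _ _ hκ ih ih' =>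
    obtain ⟨ρ, H, B, θ, -, -, -, hH, hHf, hB, hg, hθ, rfl⟩ := hκ
    obtain ⟨h1, h2⟩ := rename_guard_conditions (ih'.rename ρ) hB hg
    exact (ih.dResolvent (ih'.rename ρ) hH hHf hB h1 h2 hθ).1.rename _

/-! ### Lifting resolution steps from instances to rules -/

theorem Atom.isFunctional_rename {S : Schema.{u}} {A : Atom S (Term S)} {ρ : ℕ → ℕ} :
    (A.subst fun x => Term.var (ρ x)).IsFunctional ↔ A.IsFunctional := by
  refine exists_congr fun i => ?_
  change ((A.args i).subst _).IsFunctional ↔ _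
  cases A.args i with
  | var x => exact iff_of_false (Term.not_isFunctional_var _) (Term.not_isFunctional_var _)
  | app f ts => exact iff_of_true (Term.isFunctional_app _ _) (Term.isFunctional_app _ _)

/-- `κ` with the substitution `g` arises by resolving the instances of `σ` under `g₁` on `H` and of
`σ'` under `g₂` on `B`; the substitutions `η₁`, `η₂` map the premises into `κ`. -/
structure Resolves (Γ : Set (DisTGD S)) (σ : SkRule (shnfSchema Γ))
    (g₁ : ℕ → Term (shnfSchema Γ)) (H : Atom (shnfSchema Γ) (Term (shnfSchema Γ)))
    (σ' : SkRule (shnfSchema Γ)) (g₂ : ℕ → Term (shnfSchema Γ))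
    (B : Atom (shnfSchema Γ) (Term (shnfSchema Γ))) (κ : SkRule (shnfSchema Γ))
    (g η₁ η₂ : ℕ → Term (shnfSchema Γ)) : Prop where
  mem : DGSatEx Γ κ
  body : ∀ A ∈ κ.body, (∃ A' ∈ σ.body, A = A'.subst η₁) ∨ ∃ A' ∈ σ'.body, A' ≠ B ∧ A = A'.subst η₂
  mem_body : ∀ A ∈ σ'.body, A.subst g₂ ≠ B.subst g₂ → A.subst η₂ ∈ κ.body
  head : ∀ A ∈ κ.head, (∃ A' ∈ σ.head, A' ≠ H ∧ A = A'.subst η₁) ∨ ∃ A' ∈ σ'.head, A = A'.subst η₂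
  unif : H.subst η₁ = B.subst η₂
  left : ∀ x ∈ σ.vars, (η₁ x).subst g = g₁ x
  right : ∀ x ∈ σ'.vars, (η₂ x).subst g = g₂ x
  vars : ∀ x ∈ κ.vars, x ∈ (H.subst η₁).varList

/-- Lifting of a resolution step from instances to rules. -/
theorem exists_resolves (hΓ : ∀ τ ∈ Γ, τ.IsGuarded) {σ σ' : SkRule (shnfSchema Γ)}
    (hσ : DGSatEx Γ σ) (hσ' : DGSatEx Γ σ') (hnf : σ.IsNonFull)
    {H B : Atom (shnfSchema Γ) (Term (shnfSchema Γ))} (hH : H ∈ σ.head) (hHf : H.IsFunctional)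
    (hB : B ∈ σ'.body) (hg : (σ'.IsFull ∧ σ'.IsGuard B) ∨ B.IsFunctional)
    {g₁ g₂ : ℕ → Term (shnfSchema Γ)} (hu : H.subst g₁ = B.subst g₂) :
    ∃ κ g η₁ η₂, Resolves Γ σ g₁ H σ' g₂ B κ g η₁ η₂ := by
  classical
  obtain ⟨n, hn⟩ : ∃ n, ∀ x ∈ σ.vars, x < n := by
    obtain ⟨n, hn⟩ := σ.finite_vars.bddAbove
    exact ⟨n + 1, fun x hx => Nat.lt_succ_of_le (hn hx)⟩
  -- Shifting the variables of `σ'` beyond those of `σ` separates the rules, so `g₁` and `g₂`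
  -- combine to one unifier `g₀`.
  set ρ : ℕ → ℕ := fun x => x + n with hρ
  set r : ℕ → Term (shnfSchema Γ) := fun x => Term.var (ρ x) with hr
  set g₀ : ℕ → Term (shnfSchema Γ) := fun x => if x < n then g₁ x else g₂ (x - n) with hg₀
  have hg₀1 : ∀ x ∈ σ.vars, g₀ x = g₁ x := fun x hx => by simp [hg₀, hn x hx]
  have hg₀2 : ∀ x, (r x).subst g₀ = g₂ x := fun x => by simp [hg₀, hr, hρ, Term.subst]
  have hσr := hσ.regular hΓ
  have hσ'r := (hσ'.regular hΓ).rename ρ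
  have hB' : B.subst r ∈ (σ'.rename ρ).body := Finset.mem_image_of_mem _ hB
  have hsub2 : ∀ A : Atom (shnfSchema Γ) (Term (shnfSchema Γ)),
      (A.subst r).subst g₀ = A.subst g₂ := by
    intro A
    rw [Atom.subst_subst]
    simp only [hg₀2]
  have hunif : Atom.IsUnifier g₀ H (B.subst r) := by
    rw [Atom.IsUnifier, hsub2, ← hu]
    exact Atom.subst_congr fun x hx => hg₀1 x (SkRule.mem_vars_of_mem_head hH hx)
  obtain ⟨θ, hθ⟩ := Atom.exists_isMGU hunif
  obtain ⟨δ, hδ⟩ := hθ.2 g₀ hunif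
  have hg' : ((σ'.rename ρ).IsFull ∧ (σ'.rename ρ).IsGuard (B.subst r)) ∨
      (B.subst r).IsFunctional := by
    rcases hg with ⟨⟨h1, h2⟩, h3, h4⟩ | hg
    · refine Or.inl ⟨⟨?_, ?_⟩, hB', ?_⟩
      · intro A hA
        obtain ⟨A', hA', rfl⟩ := Finset.mem_image.1 hA
        exact fun h => h1 A' hA' (Atom.isFunctional_rename.1 h)
      · intro A hA
        obtain ⟨A', hA', rfl⟩ := Finset.mem_image.1 hA
        exact fun h => h2 A' hA' (Atom.isFunctional_rename.1 h)
      · intro x hx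
        obtain ⟨y, hy, hxy⟩ := SkRule.mem_vars_subst.1 hx
        exact Atom.mem_varList_subst.2 ⟨y, h4 y hy, hxy⟩
    · exact Or.inr (Atom.isFunctional_rename.2 hg)
  obtain ⟨h1, h2⟩ := rename_guard_conditions hσ'r hB' hg'
  obtain ⟨hreg, hvars⟩ := hσr.dResolvent hσ'r hH hHf hB' h1 h2 hθ
  set κ := dResolvent σ (σ'.rename ρ) H (B.subst r) θ with hκ
  obtain ⟨g, hgκ⟩ := hreg.exists_vnf_subst δ
  set e : ℕ → Term (shnfSchema Γ) := fun x => Term.var (κ.bodyVarList.idxOf x) with he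
  have hHθ : ∀ x ∈ (H.subst θ).varList, x ∈ κ.vars := by
    intro x hx
    obtain ⟨G, hG, hGv⟩ := hσr.guard
    obtain ⟨y, hy, hxy⟩ := Atom.mem_varList_subst.1 hx
    exact SkRule.mem_vars_of_mem_body (Finset.mem_image_of_mem _ (Finset.mem_union_left _ hG))
      (Atom.mem_varList_subst.2 ⟨y, hGv y (SkRule.mem_vars_of_mem_head hH hy), hxy⟩)
  have heg : ∀ t : Term (shnfSchema Γ), (∀ x ∈ t.varList, x ∈ κ.vars) →
      (t.subst e).subst g = t.subst δ := by
    intro t ht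
    rw [Term.subst_subst]
    exact Term.subst_congr fun x hx => hgκ x (ht x hx)
  -- The maps into the normalised resolvent: the unifier followed by the renaming `e` of the normal
  -- form, preceded on the right by the shift.
  refine ⟨κ.vnf, g, fun x => (θ x).subst e, fun x => ((r x).subst θ).subst e, ?_, ?_, ?_, ?_, ?_,
    ?_, ?_, ?_⟩
  · refine DGSatEx.step σ σ' _ hσ hσ' ⟨ρ, H, B.subst r, θ, ?_, ?_, hnf, hH, hHf, hB', hg', hθ, rfl⟩
    · intro x _ y _ hxy
      simpa [hρ] using hxy
    · rw [Set.disjoint_left]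
      intro x hx hx'
      obtain ⟨y, hy, hxy⟩ := SkRule.mem_vars_subst.1 hx'
      have h3 := hn x hx
      rw [Term.mem_varList_var.1 hxy] at h3
      simp [hρ] at h3
  · intro A hA
    obtain ⟨A₁, hA₁, rfl⟩ := Finset.mem_image.1 hA
    obtain ⟨A₂, hA₂, rfl⟩ := Finset.mem_image.1 hA₁
    rcases Finset.mem_union.1 hA₂ with hA₂ | hA₂
    · exact Or.inl ⟨A₂, hA₂, Atom.subst_subst _ _ _⟩
    · obtain ⟨hne, hA₂⟩ := Finset.mem_erase.1 hA₂
      obtain ⟨A₃, hA₃, rfl⟩ := Finset.mem_image.1 hA₂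
      refine Or.inr ⟨A₃, hA₃, fun h => hne (by rw [h]), ?_⟩
      rw [Atom.subst_subst, Atom.subst_subst]
      simp only [Term.subst_subst]
      rfl
  · intro A hA hne
    have h3 : ((A.subst r).subst θ).subst e ∈ κ.vnf.body := by
      refine Finset.mem_image_of_mem _ (Finset.mem_image_of_mem _ (Finset.mem_union_right _
        (Finset.mem_erase.2 ⟨fun h => hne ?_, Finset.mem_image_of_mem _ hA⟩)))
      change A.subst r = B.subst r at h
      rw [← hsub2, ← hsub2, h]
    rw [Atom.subst_subst, Atom.subst_subst] at h3
    simpa only [Term.subst_subst] using h3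
  · intro A hA
    obtain ⟨A₁, hA₁, rfl⟩ := Finset.mem_image.1 hA
    obtain ⟨A₂, hA₂, rfl⟩ := Finset.mem_image.1 hA₁
    rcases Finset.mem_union.1 hA₂ with hA₂ | hA₂
    · obtain ⟨hne, hA₂⟩ := Finset.mem_erase.1 hA₂
      exact Or.inl ⟨A₂, hA₂, hne, Atom.subst_subst _ _ _⟩
    · obtain ⟨A₃, hA₃, rfl⟩ := Finset.mem_image.1 hA₂
      refine Or.inr ⟨A₃, hA₃, ?_⟩
      rw [Atom.subst_subst, Atom.subst_subst]
      simp only [Term.subst_subst]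
      rfl
  · have h3 : (H.subst θ).subst e = ((B.subst r).subst θ).subst e := by
      rw [show H.subst θ = (B.subst r).subst θ from hθ.1]
    rw [Atom.subst_subst, Atom.subst_subst, Atom.subst_subst] at h3
    simpa only [Term.subst_subst] using h3
  · intro x hx
    rw [heg, ← hδ, hg₀1 x hx]
    intro y hy
    exact hHθ y (Atom.mem_varList_subst.2 ⟨x, hσr.mem_varList (Or.inr hH) hHf hx, hy⟩)
  · intro x hx
    rw [heg, Term.subst_subst]
    · simp only [← hδ, hg₀2]
    · intro y hy
      refine hHθ y ?_
      rw [show H.subst θ = (B.subst r).subst θ from hθ.1]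
      refine Atom.mem_varList_subst.2 ⟨ρ x, h1 (ρ x) ?_, hy⟩
      exact SkRule.mem_vars_subst.2 ⟨x, hx, Term.mem_varList_var.2 rfl⟩
  · intro x hx
    obtain ⟨y, hy, hxy⟩ := SkRule.mem_vars_subst.1 hx
    rw [← Atom.subst_subst]
    exact Atom.mem_varList_subst.2 ⟨y, hvars y hy, hxy⟩

end Saturation

/-! ## Saturated sets of rules have models -/

/-- A family of non-empty finite sets has a minimal hitting set. -/
theorem exists_minimal_hittingSet {α : Type*} (𝒬 : Set (Set α)) (hfin : ∀ Q ∈ 𝒬, Q.Finite)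
    (hne : ∀ Q ∈ 𝒬, Q.Nonempty) :
    ∃ X, (∀ Q ∈ 𝒬, (Q ∩ X).Nonempty) ∧ ∀ A ∈ X, ∃ Q ∈ 𝒬, Q ∩ X = {A} := by
  obtain ⟨X, -, hX⟩ := zorn_superset_nonempty {X : Set α | ∀ Q ∈ 𝒬, (Q ∩ X).Nonempty} (by
    intro c hc hch hcne
    refine ⟨⋂₀ c, fun Q hQ => ?_, fun s hs => Set.sInter_subset_of_mem hs⟩
    -- A set `Q` missing the intersection of the chain is covered by the complements of its members.
    -- As `Q` is finite and these are directed, one member already misses `Q`.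
    by_contra hcon
    have h1 : Q ⊆ ⋃₀ (compl '' c) := by
      intro q hq
      have : q ∉ ⋂₀ c := fun h => hcon ⟨q, hq, h⟩
      rw [Set.mem_sInter] at this
      push Not at this
      obtain ⟨s, hs, hqs⟩ := this
      exact ⟨sᶜ, ⟨s, hs, rfl⟩, hqs⟩
    have h2 : DirectedOn (· ⊆ ·) (compl '' c) := by
      rintro _ ⟨s, hs, rfl⟩ _ ⟨t, ht, rfl⟩
      rcases hch.total hs ht with h | h
      · exact ⟨sᶜ, ⟨s, hs, rfl⟩, subset_rfl, Set.compl_subset_compl.2 h⟩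
      · exact ⟨tᶜ, ⟨t, ht, rfl⟩, Set.compl_subset_compl.2 h, subset_rfl⟩
    obtain ⟨_, ⟨s, hs, rfl⟩, hQs⟩ := h2.exists_mem_subset_of_finite_of_subset_sUnion
      (hcne.image _) (hfin Q hQ) h1
    obtain ⟨q, hq, hqs⟩ := hc hs Q hQ
    exact hQs hq hqs) Set.univ (fun Q hQ => by simpa using hne Q hQ)
  refine ⟨X, hX.prop, fun A hA => ?_⟩
  have h1 : X \ {A} ∉ {X : Set α | ∀ Q ∈ 𝒬, (Q ∩ X).Nonempty} := by
    intro h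
    exact (hX.le_of_le h Set.sdiff_subset hA).2 rfl
  simp only [Set.mem_ofPred_eq, not_forall] at h1
  obtain ⟨Q, hQ, h2⟩ := h1
  have h3 : ∀ q ∈ Q ∩ X, q = A := by
    intro q hq
    by_contra hne
    exact h2 ⟨q, hq.1, hq.2, hne⟩
  obtain ⟨q, hq⟩ := hX.prop Q hQ
  refine ⟨Q, hQ, Set.eq_singleton_iff_unique_mem.2 ⟨?_, h3⟩⟩
  rw [← h3 q hq]
  exact hq

section Model

variable {S : Schema.{u}} {Γ : Set (DisTGD S)}

/-- The term is a variable or a function symbol applied to the terms `w`. -/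
def Term.HasArgs {S : Schema.{u}} (w : List (Term S)) (t : Term S) : Prop :=
  (∃ x, t = var x) ∨ ∃ f ts, t = app f ts ∧ List.ofFn ts = w

/-- All arguments are variables or function symbols applied to the terms `w`. -/
def Atom.HasArgs {S : Schema.{u}} (w : List (Term S)) (A : Atom S (Term S)) : Prop :=
  ∀ i, (A.args i).HasArgs w

/-- The instance of `σ` under `g` is a positive clause over the model `M` of function-free atoms
that is not satisfied in `M`. -/
structure PosInst (Γ : Set (DisTGD S)) (M : Set (Atom (shnfSchema Γ) (Term (shnfSchema Γ))))
    (w : List (Term (shnfSchema Γ))) (σ : SkRule (shnfSchema Γ)) (g : ℕ → Term (shnfSchema Γ)) :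
    Prop where
  mem : DGSatEx Γ σ
  body : ∀ A ∈ σ.body, A.subst g ∈ M
  head : ∀ A ∈ σ.head, (A.subst g).HasArgs w ∧ A.subst g ∉ M

/-- The functional atoms in the head of an instance of a rule. -/
def SkRule.funHead {S : Schema.{u}} (σ : SkRule S) (g : ℕ → Term S) : Set (Atom S (Term S)) :=
  {A | A.IsFunctional ∧ ∃ A' ∈ σ.head, A = A'.subst g}

/-- The instance of `σ` under `g` has its body in `M ∪ 𝒜`, its head is disjoint from `M`, and it
meets `X` in `𝒜` only. -/
structure PreInst (Γ : Set (DisTGD S)) (M : Set (Atom (shnfSchema Γ) (Term (shnfSchema Γ))))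
    (w : List (Term (shnfSchema Γ))) (X 𝒜 : Set (Atom (shnfSchema Γ) (Term (shnfSchema Γ))))
    (σ : SkRule (shnfSchema Γ)) (g : ℕ → Term (shnfSchema Γ)) : Prop where
  mem : DGSatEx Γ σ
  body : ∀ A ∈ σ.body, A.subst g ∈ M ∨ A.subst g ∈ 𝒜
  head : ∀ A ∈ σ.head, (A.subst g).HasArgs w ∧ A.subst g ∉ M ∧ (A.subst g ∈ X → A.subst g ∈ 𝒜)

/-- A `PreInst` that maps variables to variables. -/
structure SemiInst (Γ : Set (DisTGD S)) (M : Set (Atom (shnfSchema Γ) (Term (shnfSchema Γ))))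
    (w : List (Term (shnfSchema Γ))) (X 𝒜 : Set (Atom (shnfSchema Γ) (Term (shnfSchema Γ))))
    (σ : SkRule (shnfSchema Γ)) (g : ℕ → Term (shnfSchema Γ)) : Prop
    extends PreInst Γ M w X 𝒜 σ g where
  vars : ∀ x ∈ σ.vars, ∃ y, g x = Term.var y

theorem Atom.subst_isFunctional_iff {S : Schema.{u}} {A : Atom S (Term S)} {g : ℕ → Term S}
    (h : ∀ x ∈ A.varList, ∃ y, g x = Term.var y) : (A.subst g).IsFunctional ↔ A.IsFunctional := by
  refine exists_congr fun i => ?_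
  change ((A.args i).subst g).IsFunctional ↔ _
  cases hA : A.args i with
  | var x =>
    obtain ⟨y, hy⟩ := h x (Atom.mem_varList.2 ⟨i, by rw [hA]; exact Term.mem_varList_var.2 rfl⟩)
    refine iff_of_false ?_ (Term.not_isFunctional_var _)
    simp only [Term.subst, hy]
    exact Term.not_isFunctional_var _
  | app f ts => exact iff_of_true (Term.isFunctional_app _ _) (Term.isFunctional_app _ _)

theorem Atom.not_isFunctional_of_subst {S : Schema.{u}} {A : Atom S (Term S)} {g : ℕ → Term S}
    (h : ¬ (A.subst g).IsFunctional) : ¬ A.IsFunctional := by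
  rintro ⟨i, hi⟩
  obtain ⟨f, ts, hf⟩ := Term.isFunctional_iff.1 hi
  exact h ⟨i, by
    change ((A.args i).subst g).IsFunctional
    rw [hf]; exact Term.isFunctional_app _ _⟩

theorem Atom.exists_eq_var_of_subst {S : Schema.{u}} {A : Atom S (Term S)} {g : ℕ → Term S}
    (h : ¬ (A.subst g).IsFunctional) {x : ℕ} (hx : x ∈ A.varList) : ∃ y, g x = Term.var y := by
  obtain ⟨i, hi⟩ := Atom.mem_varList.1 hx
  have h1 : ¬ ((A.args i).subst g).IsFunctional := fun h' => h ⟨i, h'⟩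
  obtain ⟨y, hy⟩ := Term.not_isFunctional_iff.1 h1
  obtain ⟨z, hz, hgz⟩ := Term.eq_var_of_subst_eq_var hy
  rw [hz, Term.mem_varList_var] at hi
  exact ⟨y, by rw [hi, hgz]⟩

namespace Resolves

variable {σ σ' κ : SkRule (shnfSchema Γ)} {g₁ g₂ g η₁ η₂ : ℕ → Term (shnfSchema Γ)}
  {H B : Atom (shnfSchema Γ) (Term (shnfSchema Γ))}

theorem left_atom (h : Resolves Γ σ g₁ H σ' g₂ B κ g η₁ η₂)
    {A : Atom (shnfSchema Γ) (Term (shnfSchema Γ))} (hA : A ∈ σ.body ∨ A ∈ σ.head) :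
    (A.subst η₁).subst g = A.subst g₁ := by
  rw [Atom.subst_subst]
  exact Atom.subst_congr fun x hx => h.left x ⟨A, hA, hx⟩

theorem right_atom (h : Resolves Γ σ g₁ H σ' g₂ B κ g η₁ η₂)
    {A : Atom (shnfSchema Γ) (Term (shnfSchema Γ))} (hA : A ∈ σ'.body ∨ A ∈ σ'.head) :
    (A.subst η₂).subst g = A.subst g₂ := by
  rw [Atom.subst_subst]
  exact Atom.subst_congr fun x hx => h.right x ⟨A, hA, hx⟩

end Resolves

/-- All variables of `κ` come from those of `σ` through the renaming `ψ`, which therefore identifies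
no two variables if none is lost. This injectivity replaces factoring in `SemiInst.head_unique`. -/
theorem SkRule.ncard_vars_le {S : Schema.{u}} {σ κ : SkRule S} {ψ : ℕ → Term S}
    {A : Atom S (Term S)} (hA : A ∈ σ.body ∨ A ∈ σ.head)
    (hκ : ∀ x ∈ κ.vars, x ∈ (A.subst ψ).varList) (hψ : ∀ x ∈ σ.vars, ∃ y, ψ x = Term.var y) :
    κ.vars.ncard ≤ σ.vars.ncard ∧
      (σ.vars.ncard ≤ κ.vars.ncard → Set.InjOn ψ σ.vars) := by
  choose! η hη using hψ
  have h1 : κ.vars ⊆ η '' σ.vars := by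
    intro x hx
    obtain ⟨y, hy, hxy⟩ := Atom.mem_varList_subst.1 (hκ x hx)
    have hyσ : y ∈ σ.vars := ⟨A, hA, hy⟩
    rw [hη y hyσ, Term.mem_varList_var] at hxy
    exact ⟨y, hyσ, hxy.symm⟩
  have h2 := Set.ncard_le_ncard h1 (σ.finite_vars.image _)
  have h3 := Set.ncard_image_le (f := η) σ.finite_vars
  refine ⟨h2.trans h3, fun h => ?_⟩
  have h4 := Set.injOn_of_ncard_image_eq (f := η) (by omega) σ.finite_vars
  intro x hx y hy hxy
  rw [hη x hx, hη y hy] at hxy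
  exact h4 hx hy (Term.var.inj hxy)

variable {M X 𝒜 : Set (Atom (shnfSchema Γ) (Term (shnfSchema Γ)))}
  {w : List (Term (shnfSchema Γ))}

/-- Resolving a positive instance with another one. -/
theorem SemiInst.exists_resolves (hΓ : ∀ τ ∈ Γ, τ.IsGuarded) (hM : ∀ A ∈ M, ¬ A.IsFunctional)
    (hX : ∀ A ∈ X, A.IsFunctional) (h𝒜 : 𝒜 ⊆ X) {P c : SkRule (shnfSchema Γ)}
    {gP gc : ℕ → Term (shnfSchema Γ)} (hP : SemiInst Γ M w X 𝒜 P gP)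
    (hPb : ∀ A ∈ P.body, A.subst gP ∈ M) (hc : PreInst Γ M w X 𝒜 c gc)
    {H B : Atom (shnfSchema Γ) (Term (shnfSchema Γ))} (hH : H ∈ P.head) (hB : B ∈ c.body)
    (hHB : H.subst gP = B.subst gc) (hB𝒜 : B.subst gc ∈ 𝒜)
    (hg : (c.IsFull ∧ c.IsGuard B) ∨ B.IsFunctional) :
    ∃ κ g η₁ η₂, Resolves Γ P gP H c gc B κ g η₁ η₂ ∧ SemiInst Γ M w X 𝒜 κ g ∧
      κ.vars.ncard ≤ P.vars.ncard ∧
      (P.vars.ncard ≤ κ.vars.ncard → Set.InjOn η₁ P.vars) := by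
  have hHf : H.IsFunctional := by
    rw [← Atom.subst_isFunctional_iff fun x hx => hP.vars x (SkRule.mem_vars_of_mem_head hH hx), hHB]
    exact hX _ (h𝒜 hB𝒜)
  have hnf : P.IsNonFull :=
    ⟨fun A hA => Atom.not_isFunctional_of_subst (hM _ (hPb A hA)), H, hH, hHf⟩
  obtain ⟨κ, g, η₁, η₂, hR⟩ := _root_.exists_resolves hΓ hP.mem hc.mem hnf hH hHf hB hg hHB
  have hη₁ : ∀ x ∈ P.vars, ∃ y, η₁ x = Term.var y := by
    intro x hx
    obtain ⟨y, hy⟩ := hP.vars x hx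
    rw [← hR.left x hx] at hy
    obtain ⟨z, hz, -⟩ := Term.eq_var_of_subst_eq_var hy
    exact ⟨z, hz⟩
  refine ⟨κ, g, η₁, η₂, hR, ⟨⟨hR.mem, ?_, ?_⟩, ?_⟩,
    SkRule.ncard_vars_le (Or.inr hH) hR.vars hη₁⟩
  · intro A hA
    rcases hR.body A hA with ⟨A', hA', rfl⟩ | ⟨A', hA', -, rfl⟩
    · rw [hR.left_atom (Or.inl hA')]
      exact Or.inl (hPb A' hA')
    · rw [hR.right_atom (Or.inl hA')]
      exact hc.body A' hA'
  · intro A hA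
    rcases hR.head A hA with ⟨A', hA', -, rfl⟩ | ⟨A', hA', rfl⟩
    · rw [hR.left_atom (Or.inr hA')]
      exact hP.head A' hA'
    · rw [hR.right_atom (Or.inr hA')]
      exact hc.head A' hA'
  · intro x hx
    obtain ⟨y, hy, hxy⟩ := Atom.mem_varList_subst.1 (hR.vars x hx)
    have hyP := SkRule.mem_vars_of_mem_head hH hy
    obtain ⟨z, hz⟩ := hη₁ y hyP
    rw [hz, Term.mem_varList_var] at hxy
    obtain ⟨z', hz'⟩ := hP.vars y hyP
    refine ⟨z', ?_⟩
    rw [hxy, ← hz', ← hR.left y hyP, hz]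
    rfl

/-- For a functional body atom resolved in a `SemiInst`, the number of variables does not exceed
that of the second premise either. -/
theorem Resolves.ncard_vars_le_right {P c κ : SkRule (shnfSchema Γ)}
    {gP gc g η₁ η₂ : ℕ → Term (shnfSchema Γ)} {H B : Atom (shnfSchema Γ) (Term (shnfSchema Γ))}
    (hR : Resolves Γ P gP H c gc B κ g η₁ η₂) (hc : ∀ x ∈ c.vars, ∃ y, gc x = Term.var y)
    (hB : B ∈ c.body) : κ.vars.ncard ≤ c.vars.ncard := by
  refine (SkRule.ncard_vars_le (ψ := η₂) (Or.inl hB) (fun x hx => hR.unif ▸ hR.vars x hx) ?_).1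
  intro x hx
  obtain ⟨y, hy⟩ := hc x hx
  rw [← hR.right x hx] at hy
  obtain ⟨z, hz, -⟩ := Term.eq_var_of_subst_eq_var hy
  exact ⟨z, hz⟩

/-- A positive instance with a minimal number of variables has at most one head atom over a ground
atom that occurs in the body of some instance. -/
theorem SemiInst.head_unique (hΓ : ∀ τ ∈ Γ, τ.IsGuarded) (hM : ∀ A ∈ M, ¬ A.IsFunctional)
    (hX : ∀ A ∈ X, A.IsFunctional) (h𝒜 : 𝒜 ⊆ X) {P c : SkRule (shnfSchema Γ)}
    {gP gc : ℕ → Term (shnfSchema Γ)} (hP : SemiInst Γ M w X 𝒜 P gP)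
    (hPb : ∀ A ∈ P.body, A.subst gP ∈ M) (hc : SemiInst Γ M w X 𝒜 c gc)
    (hmin : ∀ κ g, SemiInst Γ M w X 𝒜 κ g → P.vars.ncard ≤ κ.vars.ncard)
    {H H' B : Atom (shnfSchema Γ) (Term (shnfSchema Γ))} (hH : H ∈ P.head) (hH' : H' ∈ P.head)
    (hB : B ∈ c.body) (hHB : H.subst gP = B.subst gc) (hHB' : H'.subst gP = B.subst gc)
    (hB𝒜 : B.subst gc ∈ 𝒜) : H = H' := by
  have hBf : B.IsFunctional := by
    rw [← Atom.subst_isFunctional_iff fun x hx => hc.vars x (SkRule.mem_vars_of_mem_body hB hx)]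
    exact hX _ (h𝒜 hB𝒜)
  -- Resolve on `H` and on `H'` separately. By minimality neither resolvent has fewer variables than
  -- `P`, so both renamings are injective on the variables of `P`.
  obtain ⟨κ, g, η₁, η₂, hR, hκ, -, hinj⟩ := hP.exists_resolves hΓ hM hX h𝒜 hPb hc.toPreInst hH hB
    hHB hB𝒜 (Or.inr hBf)
  obtain ⟨κ', g', η₁', η₂', hR', hκ', -, hinj'⟩ := hP.exists_resolves hΓ hM hX h𝒜 hPb hc.toPreInst
    hH' hB hHB' hB𝒜 (Or.inr hBf)
  replace hinj := hinj (hmin κ g hκ)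
  replace hinj' := hinj' (hmin κ' g' hκ')
  have hreg := hP.mem.regular hΓ
  have hcreg := hc.mem.regular hΓ
  obtain ⟨ℓ, hℓ⟩ := hreg.args
  obtain ⟨ℓ', hℓ'⟩ := hcreg.args
  obtain ⟨i₀, hi₀⟩ := hBf
  obtain ⟨r, a, b, rfl, rfl, hab⟩ := Atom.exists_eq_of_subst_eq hHB
  obtain ⟨r', a', b', rfl, hb', hab'⟩ := Atom.exists_eq_of_subst_eq hHB'
  cases hb'
  have hun := Atom.subst_mk_eq_iff.1 hR.unif
  have hun' := Atom.subst_mk_eq_iff.1 hR'.unif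
  obtain ⟨f, bs, hbs⟩ := Term.isFunctional_iff.1 hi₀
  change b i₀ = _ at hbs
  -- a functional position of `B` is a functional position of head atoms over the same ground atom
  have happ : ∀ {H : Atom (shnfSchema Γ) (Term (shnfSchema Γ))} (_ : H ∈ P.head) {i f}
      {ts : Fin f.arity → Term (shnfSchema Γ)}, (H.args i).subst gP = Term.app f ts →
      ∃ us, H.args i = Term.app f us ∧ List.ofFn us = ℓ.map Term.var := by
    intro H hH i f ts h
    cases hHi : H.args i with
    | var x =>
      obtain ⟨y, hy⟩ := hP.vars x (SkRule.mem_vars_of_mem_head hH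
        (Atom.mem_varList.2 ⟨i, by rw [hHi]; exact Term.mem_varList_var.2 rfl⟩))
      rw [hHi] at h
      rw [Term.subst, hy] at h
      cases h
    | app f' us =>
      rw [hHi] at h
      obtain ⟨rfl, -⟩ := Term.app_inj_ofFn h
      exact ⟨us, rfl, (hℓ H (Or.inr hH) i _ us hHi).1⟩
  have h1 := hab i₀
  rw [hbs] at h1
  obtain ⟨us, hus, husℓ⟩ := happ hH h1
  have h1' := hab' i₀
  rw [hbs] at h1'
  obtain ⟨us', hus', hus'ℓ⟩ := happ hH' h1'
  change a i₀ = _ at hus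
  change a' i₀ = _ at hus'
  obtain rfl : us = us' := List.ofFn_injective (husℓ.trans hus'ℓ.symm)
  have h2 := hun i₀
  have h2' := hun' i₀
  rw [hus, hbs] at h2
  rw [hus', hbs] at h2'
  simp only [Term.subst, Term.app.injEq, heq_eq_eq, true_and] at h2 h2'
  simp only [Atom.mk.injEq, heq_eq_eq, true_and]
  funext i
  -- Where `B` is functional, both head atoms carry the same symbol over the common list `ℓ`. Where
  -- `B` has a variable `z`, that variable recurs as the `j`-th argument of the Skolem term at `i₀`;
  -- injectivity then equates both head arguments with the `j`-th argument of the Skolem term which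
  -- the two head atoms share at `i₀`.
  cases hi : b i with
  | app e vs =>
    have h3 := hab i
    have h3' := hab' i
    rw [hi] at h3 h3'
    obtain ⟨us₁, h4, h5⟩ := happ hH h3
    obtain ⟨us₂, h6, h7⟩ := happ hH' h3'
    change a i = _ at h4
    change a' i = _ at h6
    rw [h4, h6]
    exact Term.app_eq_of_ofFn (h5.trans h7.symm)
  | var z =>
    have hz : z ∈ c.vars := SkRule.mem_vars_of_mem_body hB (Atom.mem_varList.2 ⟨i, by
      show z ∈ (b i).varList; rw [hi]; exact Term.mem_varList_var.2 rfl⟩)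
    obtain ⟨y, hy⟩ := hc.vars z hz
    have h3 := hab i
    have h3' := hab' i
    rw [hi] at h3 h3'
    change _ = gc z at h3
    change _ = gc z at h3'
    rw [hy] at h3 h3'
    obtain ⟨x, hx, -⟩ := Term.eq_var_of_subst_eq_var h3
    obtain ⟨x', hx', -⟩ := Term.eq_var_of_subst_eq_var h3'
    have hxP : x ∈ P.vars := SkRule.mem_vars_of_mem_head hH (Atom.mem_varList.2 ⟨i, by
      show x ∈ (a i).varList; rw [hx]; exact Term.mem_varList_var.2 rfl⟩)
    have hxP' : x' ∈ P.vars := SkRule.mem_vars_of_mem_head hH' (Atom.mem_varList.2 ⟨i, by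
      show x' ∈ (a' i).varList; rw [hx']; exact Term.mem_varList_var.2 rfl⟩)
    obtain ⟨h4, h5⟩ := hℓ' _ (Or.inl hB) i₀ f bs hbs
    have h6 : (Term.var z : Term (shnfSchema Γ)) ∈ List.ofFn bs := by
      rw [h4]
      exact List.mem_map_of_mem (h5 z hz)
    obtain ⟨j, hj⟩ := (List.mem_ofFn' _ _).1 h6
    obtain ⟨y', hy'⟩ := hreg.args_var (Or.inr hH) (A := ⟨r, a⟩) (i := i₀) hus j
    have hyP : y' ∈ P.vars := SkRule.mem_vars_of_mem_head hH (Atom.mem_varList.2 ⟨i₀, by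
      show y' ∈ (a i₀).varList
      rw [hus, Term.mem_varList_app]
      exact ⟨j, by rw [hy']; exact Term.mem_varList_var.2 rfl⟩⟩)
    have h7 := congrFun h2 j
    have h7' := congrFun h2' j
    have h8 := hun i
    have h8' := hun' i
    rw [hy', hj] at h7 h7'
    rw [hi, hx] at h8
    rw [hi, hx'] at h8'
    simp only [Term.subst] at h7 h7' h8 h8'
    have h9 : x = y' := hinj hxP hyP (h8.trans h7.symm)
    have h9' : x' = y' := hinj' hxP' hyP (h8'.trans h7'.symm)
    rw [hx, hx', h9, h9']

open Classical in
/-- The number of head atoms of `σ` whose instance under `g` is in `Y`. -/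
noncomputable def SkRule.headCount {S : Schema.{u}} (σ : SkRule S) (g : ℕ → Term S)
    (Y : Set (Atom S (Term S))) : ℕ := (σ.head.filter fun A => A.subst g ∈ Y).card

/-- Resolving all functional body atoms of an instance. -/
theorem SemiInst.exists_complete (hΓ : ∀ τ ∈ Γ, τ.IsGuarded) (hM : ∀ A ∈ M, ¬ A.IsFunctional)
    (hX : ∀ A ∈ X, A.IsFunctional) (h𝒜 : 𝒜 ⊆ X)
    {Y : Set (Atom (shnfSchema Γ) (Term (shnfSchema Γ)))} (hY : Y ⊆ X) {n : ℕ}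
    (hprem : ∀ c g B, SemiInst Γ M w X 𝒜 c g → B ∈ c.body → B.subst g ∈ 𝒜 →
      ∃ P gP H, SemiInst Γ M w X 𝒜 P gP ∧ (∀ A ∈ P.body, A.subst gP ∈ M) ∧ H ∈ P.head ∧
        H.subst gP = B.subst g ∧ (∀ H' ∈ P.head, H' ≠ H → H'.subst gP ∉ Y) ∧
        (B.subst g ∈ Y → P.vars.ncard ≤ n)) :
    ∀ (k : ℕ) (c : SkRule (shnfSchema Γ)) (g : ℕ → Term (shnfSchema Γ)),
      SemiInst Γ M w X 𝒜 c g → {A : Atom (shnfSchema Γ) (Term (shnfSchema Γ)) | A ∈ c.body ∧ A.subst g ∉ M}.ncard ≤ k →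
      ∃ R gR, SemiInst Γ M w X 𝒜 R gR ∧ (∀ A ∈ R.body, A.subst gR ∈ M) ∧
        R.vars.ncard ≤ c.vars.ncard ∧ R.headCount gR Y ≤ c.headCount g Y ∧
        (∀ A ∈ R.head, A.subst gR ∈ Y → ∃ A' ∈ c.head, A'.subst g = A.subst gR) ∧
        ((∃ B ∈ c.body, B.subst g ∈ Y) → R.vars.ncard ≤ n) := by
  classical
  -- Induction on the number of body atoms whose instance is outside `M`: each is resolved with a
  -- premise from `hprem`, whose own body lies in `M`. Its other head atoms avoid `Y`, so no new
  -- head atom over `Y` appears.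
  intro k
  induction k with
  | zero =>
    intro c g hc hk
    have hfin : {A : Atom (shnfSchema Γ) (Term (shnfSchema Γ)) | A ∈ c.body ∧ A.subst g ∉ M}.Finite :=
      c.body.finite_toSet.subset fun A hA => hA.1
    have h0 := (Set.ncard_eq_zero hfin).1 (Nat.le_zero.1 hk)
    have hb : ∀ A ∈ c.body, A.subst g ∈ M := by
      intro A hA
      by_contra hAM
      exact (Set.eq_empty_iff_forall_notMem.1 h0 A) ⟨hA, hAM⟩
    refine ⟨c, g, hc, hb, le_rfl, le_rfl, fun A hA _ => ⟨A, hA, rfl⟩, ?_⟩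
    rintro ⟨B, hB, hBY⟩
    exact absurd (hX _ (hY hBY)) (hM _ (hb B hB))
  | succ k ih =>
    intro c g hc hk
    by_cases hb : ∀ A ∈ c.body, A.subst g ∈ M
    · refine ⟨c, g, hc, hb, le_rfl, le_rfl, fun A hA _ => ⟨A, hA, rfl⟩, ?_⟩
      rintro ⟨B, hB, hBY⟩
      exact absurd (hX _ (hY hBY)) (hM _ (hb B hB))
    push Not at hb
    obtain ⟨B, hB, hBM⟩ := hb
    have hB𝒜 := (hc.body B hB).resolve_left hBM
    have hBf : B.IsFunctional := by
      rw [← Atom.subst_isFunctional_iff fun x hx => hc.vars x (SkRule.mem_vars_of_mem_body hB hx)]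
      exact hX _ (h𝒜 hB𝒜)
    obtain ⟨P, gP, H, hP, hPb, hH, hHB, hPY, hPn⟩ := hprem c g B hc hB hB𝒜
    obtain ⟨κ, gκ, η₁, η₂, hR, hκ, hκP, -⟩ := hP.exists_resolves hΓ hM hX h𝒜 hPb hc.toPreInst hH hB
      hHB hB𝒜 (Or.inr hBf)
    have hκc := hR.ncard_vars_le_right hc.vars hB
    have hfin : {A : Atom (shnfSchema Γ) (Term (shnfSchema Γ)) | A ∈ c.body ∧ A.subst g ∉ M}.Finite :=
      c.body.finite_toSet.subset fun A hA => hA.1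
    have hcount : {A | A ∈ κ.body ∧ A.subst gκ ∉ M}.ncard ≤ k := by
      have h1 : {A | A ∈ κ.body ∧ A.subst gκ ∉ M} ⊆
          (Atom.subst η₂) '' ({A : Atom (shnfSchema Γ) (Term (shnfSchema Γ)) | A ∈ c.body ∧ A.subst g ∉ M} \ {B}) := by
        rintro A ⟨hA, hAM⟩
        rcases hR.body A hA with ⟨A', hA', rfl⟩ | ⟨A', hA', hne, rfl⟩
        · rw [hR.left_atom (Or.inl hA')] at hAM
          exact absurd (hPb A' hA') hAM
        · rw [hR.right_atom (Or.inl hA')] at hAM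
          exact ⟨A', ⟨⟨hA', hAM⟩, hne⟩, rfl⟩
      have h2 := Set.ncard_le_ncard h1 ((hfin.subset Set.sdiff_subset).image _)
      have h3 := Set.ncard_image_le (f := Atom.subst η₂) (hfin.subset (Set.sdiff_subset (t := {B})))
      have h4 := Set.ncard_sdiff_singleton_of_mem
        (show B ∈ {A : Atom (shnfSchema Γ) (Term (shnfSchema Γ)) | A ∈ c.body ∧ A.subst g ∉ M} from ⟨hB, hBM⟩)
      omega
    obtain ⟨R, gR, h1, h2, h3, h4, h5, h6⟩ := ih κ gκ hκ hcount
    have hhead : ∀ A ∈ κ.head, A.subst gκ ∈ Y →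
        ∃ A' ∈ c.head, A = A'.subst η₂ ∧ A'.subst g = A.subst gκ := by
      intro A hA hAY
      rcases hR.head A hA with ⟨A', hA', hne, rfl⟩ | ⟨A', hA', rfl⟩
      · rw [hR.left_atom (Or.inr hA')] at hAY
        exact absurd hAY (hPY A' hA' hne)
      · exact ⟨A', hA', rfl, (hR.right_atom (Or.inr hA')).symm⟩
    refine ⟨R, gR, h1, h2, h3.trans hκc, h4.trans ?_, ?_, ?_⟩
    · refine (Finset.card_le_card (t := (c.head.filter fun A => A.subst g ∈ Y).image
        (Atom.subst η₂)) ?_).trans Finset.card_image_le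
      intro A hA
      obtain ⟨hA1, hA2⟩ := Finset.mem_filter.1 hA
      obtain ⟨A', hA', rfl, h7⟩ := hhead A hA1 hA2
      exact Finset.mem_image_of_mem _ (Finset.mem_filter.2 ⟨hA', h7 ▸ hA2⟩)
    · intro A hA hAY
      obtain ⟨A', hA', h7⟩ := h5 A hA hAY
      obtain ⟨A'', hA'', -, h8⟩ := hhead A' hA' (h7 ▸ hAY)
      exact ⟨A'', hA'', h8.trans h7⟩
    · rintro ⟨B', hB', hB'Y⟩
      -- Resolving an atom of `Y` brings the number of variables down to `n`. If `B` is not over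
      -- `Y`, then `B'` has a different instance and survives in the body of `κ`.
      by_cases hBY : B.subst g ∈ Y
      · exact h3.trans (hκP.trans (hPn hBY))
      · refine h6 ⟨B'.subst η₂, hR.mem_body B' hB' (fun h => hBY (h ▸ hB'Y)), ?_⟩
        rw [hR.right_atom (Or.inl hB')]
        exact hB'Y

/-- The guard contains all variables, and its instance is a function-free atom of `M`. -/
theorem PosInst.vars_var (hΓ : ∀ τ ∈ Γ, τ.IsGuarded) (hM : ∀ A ∈ M, ¬ A.IsFunctional)
    {σ : SkRule (shnfSchema Γ)} {g : ℕ → Term (shnfSchema Γ)} (h : PosInst Γ M w σ g) :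
    ∀ x ∈ σ.vars, ∃ y, g x = Term.var y := by
  intro x hx
  obtain ⟨G, hG, hGv⟩ := (h.mem.regular hΓ).guard
  exact Atom.exists_eq_var_of_subst (hM _ (h.body G hG)) (hGv x hx)

/-- Let `M` be closed under the full rules of the saturation and let `X` be a minimal hitting set of
the positive instances. Then `M ∪ X` satisfies the full rules of the saturation. -/
theorem exists_head_mem_of_full (hΓ : ∀ τ ∈ Γ, τ.IsGuarded) (hM : ∀ A ∈ M, ¬ A.IsFunctional)
    (hMcl : ∀ σ, DGSatEx Γ σ → σ.IsFull → ∀ g, (∀ A ∈ σ.body, A.subst g ∈ M) →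
      ∃ A ∈ σ.head, A.subst g ∈ M)
    (hXhit : ∀ σ g, PosInst Γ M w σ g → (σ.funHead g ∩ X).Nonempty)
    (hXmin : ∀ A ∈ X, ∃ σ g, PosInst Γ M w σ g ∧ σ.funHead g ∩ X = {A})
    {τ : SkRule (shnfSchema Γ)} (hτ : DGSatEx Γ τ) (hτf : τ.IsFull)
    {g₂ : ℕ → Term (shnfSchema Γ)} (hg₂ : ∀ x ∈ τ.vars, (g₂ x).HasArgs w)
    (hbody : ∀ A ∈ τ.body, A.subst g₂ ∈ M ∨ A.subst g₂ ∈ X) :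
    ∃ A ∈ τ.head, A.subst g₂ ∈ M ∨ A.subst g₂ ∈ X := by
  classical
  by_contra hcon
  push Not at hcon
  have hX : ∀ A ∈ X, A.IsFunctional := by
    intro A hA
    obtain ⟨σ, g, -, h⟩ := hXmin A hA
    have h1 : A ∈ σ.funHead g ∩ X := by rw [h]; rfl
    exact h1.1.1
  have hMX : ∀ A ∈ X, A ∉ M := fun A hA h => hM A h (hX A hA)
  obtain ⟨G, hG, hGv⟩ := (hτ.regular hΓ).guard
  -- A guard instance in `M` would make all body instances function-free, hence in `M`, and closure
  -- of `M` would satisfy the head.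
  have hGM : G.subst g₂ ∉ M := by
    intro hGM
    have hb : ∀ A ∈ τ.body, A.subst g₂ ∈ M := by
      intro A hA
      refine (hbody A hA).resolve_right fun hAX => hτf.1 A hA ?_
      rw [← Atom.subst_isFunctional_iff]
      · exact hX _ hAX
      · exact fun x hx => Atom.exists_eq_var_of_subst (hM _ hGM)
          (hGv x (SkRule.mem_vars_of_mem_body hA hx))
    obtain ⟨A, hA, hAM⟩ := hMcl τ hτ hτf g₂ hb
    exact (hcon A hA).1 hAM
  have hGX : G.subst g₂ ∈ X := (hbody G hG).resolve_left hGM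
  set 𝒜 : Set (Atom (shnfSchema Γ) (Term (shnfSchema Γ))) :=
    {A | A ∈ X ∧ ∃ B ∈ τ.body, B.subst g₂ = A}
  have h𝒜 : 𝒜 ⊆ X := fun A hA => hA.1
  have hτpre : PreInst Γ M w X 𝒜 τ g₂ := by
    refine ⟨hτ, fun A hA => (hbody A hA).imp id fun h => ⟨h, A, hA, rfl⟩, fun A hA => ⟨?_,
      (hcon A hA).1, fun h => absurd h (hcon A hA).2⟩⟩
    intro i
    have h1 : ¬ (A.args i).IsFunctional := fun h => hτf.2 A hA ⟨i, h⟩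
    obtain ⟨x, hx⟩ := Term.not_isFunctional_iff.1 h1
    change ((A.args i).subst g₂).HasArgs w
    rw [hx]
    exact hg₂ x (SkRule.mem_vars_of_mem_head hA
      (Atom.mem_varList.2 ⟨i, by rw [hx]; exact Term.mem_varList_var.2 rfl⟩))
  -- positive instances over single atoms of `𝒜`
  have hunit : ∀ A ∈ 𝒜, ∃ P gP H, SemiInst Γ M w X 𝒜 P gP ∧ (∀ A ∈ P.body, A.subst gP ∈ M) ∧
      H ∈ P.head ∧ H.subst gP = A ∧ ∀ H' ∈ P.head, H'.subst gP ∈ X → H'.subst gP = A := by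
    intro A hA
    obtain ⟨σ, g, hσ, h⟩ := hXmin A hA.1
    have h1 : A ∈ σ.funHead g ∩ X := by rw [h]; rfl
    obtain ⟨⟨-, H, hH, hHA⟩, -⟩ := h1
    have h2 : ∀ H' ∈ σ.head, H'.subst g ∈ X → H'.subst g = A := by
      intro H' hH' hX'
      have : H'.subst g ∈ σ.funHead g ∩ X := ⟨⟨hX _ hX', H', hH', rfl⟩, hX'⟩
      rw [h] at this
      exact this
    refine ⟨σ, g, H, ⟨⟨hσ.mem, fun B hB => Or.inl (hσ.body B hB), fun B hB => ⟨(hσ.head B hB).1,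
      (hσ.head B hB).2, fun hBX => ?_⟩⟩, hσ.vars_var hΓ hM⟩, hσ.body, hH, hHA.symm, h2⟩
    rw [h2 B hB hBX]
    exact hA
  have hG𝒜 : G.subst g₂ ∈ 𝒜 := ⟨hGX, G, hG, rfl⟩
  -- the minimal number of variables
  obtain ⟨n, ⟨c₀, gc₀, hc₀, hc₀n⟩, hmin⟩ : ∃ n, (∃ c g, SemiInst Γ M w X 𝒜 c g ∧ c.vars.ncard = n) ∧
      ∀ c g, SemiInst Γ M w X 𝒜 c g → n ≤ c.vars.ncard := by
    have hne : ∃ n, ∃ c g, SemiInst Γ M w X 𝒜 c g ∧ c.vars.ncard = n := by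
      obtain ⟨P, gP, -, hP, -⟩ := hunit _ hG𝒜
      exact ⟨_, P, gP, hP, rfl⟩
    exact ⟨Nat.find hne, Nat.find_spec hne, fun c g hc => Nat.find_min' hne ⟨c, g, hc, rfl⟩⟩
  -- A positive instance with at most `n` variables. It makes the family defining `Y` non-empty, and
  -- thereby `Y` itself.
  obtain ⟨R₀, gR₀, hR₀, hR₀b, hR₀n, -⟩ := hc₀.exists_complete (Y := ∅) (n := n) hΓ hM hX h𝒜
    (Set.empty_subset _) (by
      intro c g B hc hB hB𝒜
      obtain ⟨P, gP, H, hP, hPb, hH, hHB, -⟩ := hunit _ hB𝒜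
      exact ⟨P, gP, H, hP, hPb, hH, hHB, fun _ _ _ => Set.notMem_empty _,
        fun h => absurd h (Set.notMem_empty _)⟩) _ _ _ le_rfl
  have hpos : ∀ {P gP}, SemiInst Γ M w X 𝒜 P gP → (∀ A ∈ P.body, A.subst gP ∈ M) →
      PosInst Γ M w P gP :=
    fun hP hPb => ⟨hP.mem, hPb, fun A hA => ⟨(hP.head A hA).1, (hP.head A hA).2.1⟩⟩
  -- Minimality of `Y` supplies, for each of its atoms, a positive instance with at most `n`
  -- variables that meets `Y` in this atom only.
  obtain ⟨Y, hYhit, hYmin⟩ := exists_minimal_hittingSet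
    {T | ∃ P gP, SemiInst Γ M w X 𝒜 P gP ∧ (∀ A ∈ P.body, A.subst gP ∈ M) ∧ P.vars.ncard ≤ n ∧
      T = P.funHead gP ∩ X} (by
      rintro T ⟨P, gP, -, -, -, rfl⟩
      refine (P.head.image (Atom.subst gP)).finite_toSet.subset ?_
      rintro A ⟨⟨-, A', hA', rfl⟩, -⟩
      exact Finset.mem_coe.2 (Finset.mem_image_of_mem _ hA')) (by
      rintro T ⟨P, gP, hP, hPb, -, rfl⟩
      exact hXhit P gP (hpos hP hPb))
  have hY𝒜 : Y ⊆ 𝒜 := by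
    intro A hA
    obtain ⟨T, ⟨P, gP, hP, -, -, rfl⟩, hT⟩ := hYmin A hA
    have h1 : A ∈ P.funHead gP ∩ X ∩ Y := by rw [hT]; rfl
    obtain ⟨⟨⟨-, A', hA', rfl⟩, hAX⟩, -⟩ := h1
    exact (hP.head A' hA').2.2 hAX
  have hYX := hY𝒜.trans h𝒜
  -- For atoms in `Y` the premise comes from minimality of `Y`, and `SemiInst.head_unique` makes `H`
  -- its only head atom over `Y`. For the others, a premise meeting `X` only outside `Y` is enough.
  have hprem : ∀ c g B, SemiInst Γ M w X 𝒜 c g → B ∈ c.body → B.subst g ∈ 𝒜 →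
      ∃ P gP H, SemiInst Γ M w X 𝒜 P gP ∧ (∀ A ∈ P.body, A.subst gP ∈ M) ∧ H ∈ P.head ∧
        H.subst gP = B.subst g ∧ (∀ H' ∈ P.head, H' ≠ H → H'.subst gP ∉ Y) ∧
        (B.subst g ∈ Y → P.vars.ncard ≤ n) := by
    intro c g B hc hB hB𝒜
    by_cases hBY : B.subst g ∈ Y
    · obtain ⟨T, ⟨P, gP, hP, hPb, hPn, rfl⟩, hT⟩ := hYmin _ hBY
      have h1 : B.subst g ∈ P.funHead gP ∩ X ∩ Y := by rw [hT]; rfl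
      obtain ⟨⟨⟨-, H, hH, hHB⟩, -⟩, -⟩ := h1
      refine ⟨P, gP, H, hP, hPb, hH, hHB.symm, fun H' hH' hne hH'Y => hne ?_, fun _ => hPn⟩
      have h2 : H'.subst gP ∈ P.funHead gP ∩ X ∩ Y :=
        ⟨⟨⟨hX _ (hYX hH'Y), H', hH', rfl⟩, hYX hH'Y⟩, hH'Y⟩
      rw [hT] at h2
      exact hP.head_unique hΓ hM hX h𝒜 hPb hc (fun κ g hκ => hPn.trans (hmin κ g hκ)) hH' hH hB h2
        hHB.symm hB𝒜
    · obtain ⟨P, gP, H, hP, hPb, hH, hHB, h1⟩ := hunit _ hB𝒜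
      exact ⟨P, gP, H, hP, hPb, hH, hHB, fun H' hH' _ hH'Y => hBY (h1 H' hH' (hYX hH'Y) ▸ hH'Y),
        fun h => absurd h hBY⟩
  -- Resolve `H` with the guard of `τ`, then all remaining functional body atoms. The head of `τ`
  -- avoids `X`, so all head atoms over `Y` descend from those of `P` other than `H`.
  have hstep : ∀ P gP H, SemiInst Γ M w X 𝒜 P gP → (∀ A ∈ P.body, A.subst gP ∈ M) → H ∈ P.head →
      H.subst gP = G.subst g₂ →
      ∃ R gR, SemiInst Γ M w X 𝒜 R gR ∧ (∀ A ∈ R.body, A.subst gR ∈ M) ∧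
        R.vars.ncard ≤ P.vars.ncard ∧
        R.headCount gR Y ≤ ((P.head.filter fun A => A.subst gP ∈ Y).erase H).card ∧
        (∀ A ∈ R.head, A.subst gR ∈ Y → ∃ A' ∈ P.head, A'.subst gP = A.subst gR) ∧
        ((∃ A ∈ Y, A ≠ G.subst g₂) → R.vars.ncard ≤ n) := by
    intro P gP H hP hPb hH hHG
    obtain ⟨c, gc, η₁, η₂, hR, hc, hcP, -⟩ := hP.exists_resolves hΓ hM hX h𝒜 hPb hτpre hH hG
      hHG hG𝒜 (Or.inl ⟨hτf, hG, hGv⟩)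
    obtain ⟨R, gR, h1, h2, h3, h4, h5, h6⟩ :=
      hc.exists_complete hΓ hM hX h𝒜 hYX hprem _ _ _ le_rfl
    have hhead : ∀ A ∈ c.head, A.subst gc ∈ Y →
        ∃ A' ∈ P.head, A' ≠ H ∧ A = A'.subst η₁ ∧ A'.subst gP = A.subst gc := by
      intro A hA hAY
      rcases hR.head A hA with ⟨A', hA', hne, rfl⟩ | ⟨A', hA', rfl⟩
      · exact ⟨A', hA', hne, rfl, (hR.left_atom (Or.inr hA')).symm⟩
      · rw [hR.right_atom (Or.inr hA')] at hAY
        exact absurd (hYX hAY) (hcon A' hA').2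
    refine ⟨R, gR, h1, h2, h3.trans hcP, h4.trans ?_, ?_, ?_⟩
    · refine (Finset.card_le_card (t := ((P.head.filter fun A => A.subst gP ∈ Y).erase H).image
        (Atom.subst η₁)) ?_).trans Finset.card_image_le
      intro A hA
      obtain ⟨hA1, hA2⟩ := Finset.mem_filter.1 hA
      obtain ⟨A', hA', hne, rfl, h7⟩ := hhead A hA1 hA2
      exact Finset.mem_image_of_mem _ (Finset.mem_erase.2 ⟨hne, Finset.mem_filter.2
        ⟨hA', h7 ▸ hA2⟩⟩)
    · intro A hA hAY
      obtain ⟨A', hA', h7⟩ := h5 A hA hAY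
      obtain ⟨A'', hA'', -, -, h8⟩ := hhead A' hA' (h7 ▸ hAY)
      exact ⟨A'', hA'', h8.trans h7⟩
    · rintro ⟨A, hAY, hne⟩
      obtain ⟨B, hB, rfl⟩ := (hY𝒜 hAY).2
      refine h6 ⟨B.subst η₂, hR.mem_body B hB hne, ?_⟩
      rw [hR.right_atom (Or.inl hB)]
      exact hAY
  have hhit : ∀ P gP, SemiInst Γ M w X 𝒜 P gP → (∀ A ∈ P.body, A.subst gP ∈ M) →
      P.vars.ncard ≤ n → ∃ A ∈ P.head, A.subst gP ∈ Y := by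
    intro P gP hP hPb hPn
    obtain ⟨A, ⟨⟨-, A', hA', rfl⟩, -⟩, hAY⟩ := hYhit _ ⟨P, gP, hP, hPb, hPn, rfl⟩
    exact ⟨A', hA', hAY⟩
  by_cases hGY : G.subst g₂ ∈ Y
  -- Infinite descent: each result must still meet `Y`, necessarily in the guard instance, but with
  -- fewer head atoms over it. Several such head atoms are possible because `τ` need not be a
  -- `SemiInst`, so `SemiInst.head_unique` does not apply.
  · have key : ∀ m P gP, SemiInst Γ M w X 𝒜 P gP → (∀ A ∈ P.body, A.subst gP ∈ M) →
        P.vars.ncard ≤ n → (∀ A ∈ P.head, A.subst gP ∈ Y → A.subst gP = G.subst g₂) →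
        P.headCount gP Y = m → False := by
      intro m
      induction m using Nat.strong_induction_on with
      | _ m ih =>
        intro P gP hP hPb hPn hPG hm
        obtain ⟨H, hH, hHY⟩ := hhit P gP hP hPb hPn
        obtain ⟨R, gR, h1, h2, h3, h4, h5, -⟩ := hstep P gP H hP hPb hH (hPG H hH hHY)
        have h6 : R.headCount gR Y < m := by
          rw [← hm]
          exact h4.trans_lt (Finset.card_erase_lt_of_mem (Finset.mem_filter.2 ⟨hH, hHY⟩))
        refine ih _ h6 R gR h1 h2 (h3.trans hPn) ?_ rfl
        intro A hA hAY
        obtain ⟨A', hA', h7⟩ := h5 A hA hAY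
        rw [← h7]
        exact hPG A' hA' (h7 ▸ hAY)
    obtain ⟨T, ⟨P, gP, hP, hPb, hPn, rfl⟩, hT⟩ := hYmin _ hGY
    refine key _ P gP hP hPb hPn ?_ rfl
    intro A hA hAY
    have h1 : A.subst gP ∈ P.funHead gP ∩ X ∩ Y :=
      ⟨⟨⟨hX _ (hYX hAY), A, hA, rfl⟩, hYX hAY⟩, hAY⟩
    rw [hT] at h1
    exact h1
  -- Start from a positive instance meeting `X` only in the guard instance. Since `Y` contains
  -- another body fact of `τ`, the result has at most `n` variables and must meet `Y`; but its head
  -- atoms over `Y` can only be the guard instance, which is not in `Y`.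
  · obtain ⟨P, gP, H, hP, hPb, hH, hHG, hPG⟩ := hunit _ hG𝒜
    obtain ⟨R, gR, h1, h2, h3, h4, h5, h6⟩ := hstep P gP H hP hPb hH hHG
    obtain ⟨A₀, hA₀, hA₀Y⟩ := hhit R₀ gR₀ hR₀ hR₀b (hR₀n.trans hc₀n.le)
    obtain ⟨A, hA, hAY⟩ := hhit R gR h1 h2 (h6 ⟨_, hA₀Y, fun h => hGY (h ▸ hA₀Y)⟩)
    obtain ⟨A', hA', h7⟩ := h5 A hA hAY
    rw [← h7] at hAY
    exact hGY (hPG A' hA' (hYX hAY) ▸ hAY)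

end Model

/-! ## The full rules of the saturation as DisTGDs -/

section Translation

variable {S : Schema.{u}}

theorem Atom.map_map {X Y Z : Type*} (f : X → Y) (g : Y → Z) (A : Atom S X) :
    (A.map f).map g = A.map (g ∘ f) := rfl

theorem Atom.map_congr {X Y : Type*} {f g : X → Y} {A : Atom S X} (h : ∀ i, f (A.args i) = g (A.args i)) :
    A.map f = A.map g := by
  obtain ⟨r, a⟩ := A
  simp only [Atom.map, Atom.mk.injEq, heq_eq_eq, true_and]
  exact funext h

theorem Atom.map_injective {X Y : Type*} {f : X → Y} (hf : Function.Injective f) :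
    Function.Injective (Atom.map (S := S) f) := by
  rintro ⟨r, a⟩ ⟨r', a'⟩ h
  simp only [Atom.map, Atom.mk.injEq] at h
  obtain ⟨rfl, h⟩ := h
  rw [hf.comp_left (eq_of_heq h)]

theorem Atom.map_var_injective : Function.Injective (Atom.map (S := S) (Term.var (S := S))) :=
  Atom.map_injective fun _ _ h => Term.var.inj h

theorem Atom.exists_eq_map_var {A : Atom S (Term S)} (hA : ¬ A.IsFunctional) :
    ∃ A' : Atom S ℕ, A = A'.map Term.var := by
  obtain ⟨r, a⟩ := A
  have h : ∀ i, ∃ x, a i = Term.var x := fun i =>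
    Term.not_isFunctional_iff.1 fun h => hA ⟨i, h⟩
  choose x hx using h
  refine ⟨⟨r, x⟩, ?_⟩
  simp only [Atom.map, Atom.mk.injEq, heq_eq_eq, true_and]
  exact funext hx

theorem Atom.not_isFunctional_map_var (A : Atom S ℕ) : ¬ (A.map Term.var : Atom S _).IsFunctional :=
  fun ⟨_, hi⟩ => Term.not_isFunctional_var _ hi

theorem Atom.mem_varList_map_var {A : Atom S ℕ} {x : ℕ} :
    x ∈ (A.map Term.var : Atom S (Term S)).varList ↔ ∃ i, A.args i = x := by
  rw [Atom.mem_varList]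
  exact exists_congr fun i => Term.mem_varList_var.trans eq_comm

theorem Atom.subst_map_var (A : Atom S ℕ) (g : ℕ → Term S) :
    (A.map Term.var).subst g = A.map g := rfl

/-- The function-free rule `σ` and the DisTGD `τ` are the same rule. -/
structure Represents (σ : SkRule S) (τ : DisTGD S) : Prop where
  mem_body : ∀ A, A ∈ σ.body ↔ ∃ A' ∈ τ.body, A = A'.map Term.var
  head : ∀ D, D ∈ τ.head ↔ ∃ A : Atom S ℕ, D = {A} ∧ A.map Term.var ∈ σ.head
  mem_head : ∀ A ∈ σ.head, ∃ A' : Atom S ℕ, A = A'.map Term.var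

theorem Represents.isFull {σ : SkRule S} {τ : DisTGD S} (h : Represents σ τ) : σ.IsFull := by
  constructor
  · intro A hA
    obtain ⟨A', -, rfl⟩ := (h.mem_body A).1 hA
    exact A'.not_isFunctional_map_var
  · intro A hA
    obtain ⟨A', rfl⟩ := h.mem_head A hA
    exact A'.not_isFunctional_map_var

/-- The variables of a head atom of the DisTGD of a regular full rule occur in its body. -/
theorem Represents.mem_bodyVars {σ : SkRule S} {τ : DisTGD S} (h : Represents σ τ)
    (hσ : σ.Regular) {A : Atom S ℕ} (hA : A.map Term.var ∈ σ.head) (i : Fin (S.arity A.rel)) :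
    A.args i ∈ τ.bodyVars := by
  obtain ⟨G, hG, hGv⟩ := hσ.guard
  have h1 := hGv _ (SkRule.mem_vars_of_mem_head hA (Atom.mem_varList_map_var.2 ⟨i, rfl⟩))
  obtain ⟨G', hG', rfl⟩ := (h.mem_body G).1 hG
  exact mem_conjVars.2 ⟨G', hG', Atom.mem_varList_map_var.1 h1⟩

theorem DisTGD.mem_exVars {τ : DisTGD S} {D : Finset (Atom S ℕ)} {x : ℕ} :
    x ∈ τ.exVars D ↔ (∃ A ∈ D, ∃ i, A.args i = x) ∧ x ∉ τ.bodyVars := by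
  simp only [DisTGD.exVars, Finset.mem_sdiff, mem_conjVars]

theorem DisTGD.fullPart_singleton {τ : DisTGD S} {A : Atom S ℕ}
    (h : (τ.fullPart {A}).Nonempty) : (∀ i, A.args i ∈ τ.bodyVars) ∧ τ.fullPart {A} = {A} := by
  obtain ⟨B, hB⟩ := h
  obtain ⟨h1, h2⟩ := Finset.mem_filter.1 hB
  obtain rfl := Finset.mem_singleton.1 h1
  refine ⟨fun i => ?_, ?_⟩
  · by_contra hcon
    exact Finset.disjoint_left.1 h2 (Finset.mem_image_of_mem _ (Finset.mem_univ i))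
      (DisTGD.mem_exVars.2 ⟨⟨B, h1, i, rfl⟩, hcon⟩)
  · rw [DisTGD.fullPart, Finset.filter_singleton, if_pos h2]

theorem DisTGD.fullPart_singleton_of_mem {τ : DisTGD S} {A : Atom S ℕ}
    (h : ∀ i, A.args i ∈ τ.bodyVars) : τ.fullPart {A} = {A} := by
  rw [DisTGD.fullPart, Finset.filter_singleton, if_pos]
  rw [Finset.disjoint_left]
  intro x _ hx
  obtain ⟨⟨B, hB, i, rfl⟩, hx⟩ := DisTGD.mem_exVars.1 hx
  cases Finset.mem_singleton.1 hB
  exact hx (h i)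

/-- Rules with atomic head conjunctions are not changed by taking immediate full consequences. -/
theorem DisTGD.ifc_eq_self {τ : DisTGD S} (h : τ.HasIFC) (hs : ∀ D ∈ τ.head, ∃ A, D = {A}) :
    τ.ifc h = τ := by
  classical
  refine DisTGD.ext rfl ?_
  have h1 : Set.EqOn τ.fullPart id τ.head := by
    intro D hD
    obtain ⟨A, rfl⟩ := hs D hD
    exact (DisTGD.fullPart_singleton (h _ hD)).2
  show τ.head.image τ.fullPart = τ.head
  rw [Finset.image_congr h1, Finset.image_id]

theorem DisTGD.ifc_isFull {τ : DisTGD S} (h : τ.HasIFC) : (τ.ifc h).IsFull := by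
  classical
  intro D hD
  obtain ⟨D', hD', rfl⟩ := Finset.mem_image.1 hD
  refine Finset.eq_empty_of_forall_notMem fun x hx => ?_
  obtain ⟨⟨A, hA, i, rfl⟩, hx⟩ := DisTGD.mem_exVars.1 hx
  obtain ⟨h1, h2⟩ := Finset.mem_filter.1 hA
  exact Finset.disjoint_left.1 h2 (Finset.mem_image_of_mem _ (Finset.mem_univ i))
    (DisTGD.mem_exVars.2 ⟨⟨A, h1, i, rfl⟩, hx⟩)

variable {Γ : Set (DisTGD S)}

/-- Heads are disjunctions of single atoms, so the immediate full consequence exists only if no head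
atom has an existential variable. Functional terms become variables outside the body, hence there
were none. -/
theorem exists_represents_of_mem_DGSat {τ : DisTGD (shnfSchema Γ)} (h : τ ∈ DGSat Γ) :
    ∃ σ, DGSatEx Γ σ ∧ Represents σ τ := by
  classical
  obtain ⟨δ, ⟨σ, hσ, g, hg, -, hgv, hb, hh⟩, hifc, rfl⟩ := h
  have hbody : ∀ A, A ∈ σ.body ↔ ∃ A' ∈ δ.body, A = A'.map Term.var := by
    intro A
    rw [hb, Finset.mem_image]
    simp only [eq_comm]
  have hs : ∀ D ∈ δ.head, ∃ A, D = {A} := by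
    intro D hD
    rw [hh] at hD
    obtain ⟨A, -, rfl⟩ := Finset.mem_image.1 hD
    exact ⟨_, rfl⟩
  rw [DisTGD.ifc_eq_self hifc hs]
  have hhead : ∀ A ∈ σ.head, (A.map g).map Term.var = A := by
    intro A hA
    have hD : {A.map g} ∈ δ.head := by
      rw [hh]
      exact Finset.mem_image_of_mem _ hA
    have h1 := (DisTGD.fullPart_singleton (hifc _ hD)).1
    obtain ⟨A', rfl⟩ : ∃ A' : Atom _ ℕ, A = A'.map Term.var := by
      refine Atom.exists_eq_map_var ?_
      rintro ⟨i, hi⟩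
      obtain ⟨B, hB, j, hj⟩ := mem_conjVars.1 (h1 i)
      refine hgv A hA i hi ⟨B.map Term.var, Or.inl ((hbody _).2 ⟨B, hB, rfl⟩), ?_⟩
      exact Atom.mem_varList_map_var.2 ⟨j, hj⟩
    rw [Atom.map_map, Atom.map_map]
    exact Atom.map_congr fun i => by simp [hg]
  refine ⟨σ, hσ, hbody, fun D => ?_, fun A hA => ⟨A.map g, (hhead A hA).symm⟩⟩
  rw [hh, Finset.mem_image]
  constructor
  · rintro ⟨A, hA, rfl⟩
    exact ⟨A.map g, rfl, by rw [hhead A hA]; exact hA⟩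
  · rintro ⟨A, rfl, hA⟩
    refine ⟨_, hA, ?_⟩
    rw [Atom.map_map, show g ∘ Term.var = id from funext hg]
    rfl

theorem exists_mem_DGSat_of_isFull (hΓ : ∀ τ ∈ Γ, τ.IsGuarded) {σ : SkRule (shnfSchema Γ)}
    (hσ : DGSatEx Γ σ) (hf : σ.IsFull) : ∃ τ ∈ DGSat Γ, Represents σ τ := by
  classical
  have hreg := hσ.regular hΓ
  set g : Term (shnfSchema Γ) → ℕ := fun t => if h : ∃ x, t = Term.var x then h.choose else 0 with hgdef
  have hg : ∀ x, g (Term.var x) = x := by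
    intro x
    have h : ∃ y, (Term.var x : Term (shnfSchema Γ)) = Term.var y := ⟨x, rfl⟩
    rw [hgdef]
    simp only [dif_pos h]
    exact (Term.var.inj h.choose_spec).symm
  have hmap : ∀ A : Atom (shnfSchema Γ) ℕ, (A.map Term.var).map g = A := fun A => by
    rw [Atom.map_map, show g ∘ Term.var = id from funext hg]
    rfl
  have hmap' : ∀ A, (A ∈ σ.body ∨ A ∈ σ.head) → (A.map g).map Term.var = A := by
    intro A hA
    obtain ⟨A', rfl⟩ := Atom.exists_eq_map_var (hA.elim (hf.1 A) (hf.2 A))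
    rw [hmap]
  let δ : DisTGD (shnfSchema Γ) :=
    { body := σ.body.image (Atom.map g)
      head := σ.head.image fun A => {A.map g}
      head_nonempty := hreg.head_nonempty.image _
      conj_nonempty := by
        intro D hD
        obtain ⟨A, -, rfl⟩ := Finset.mem_image.1 hD
        exact Finset.singleton_nonempty _ }
  have hbody : σ.body = δ.body.image (Atom.map Term.var) := by
    show _ = (σ.body.image (Atom.map g)).image (Atom.map Term.var)
    rw [Finset.image_image]
    conv_lhs => rw [← Finset.image_id (s := σ.body)]
    exact Finset.image_congr fun A hA => (hmap' A (Or.inl hA)).symm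
  have hrep : Represents σ δ := by
    refine ⟨fun A => ?_, fun D => ?_, fun A hA => ⟨_, (hmap' A (Or.inr hA)).symm⟩⟩
    · rw [hbody, Finset.mem_image]
      simp only [eq_comm]
    · rw [Finset.mem_image]
      constructor
      · rintro ⟨A, hA, rfl⟩
        exact ⟨_, rfl, by rw [hmap' A (Or.inr hA)]; exact hA⟩
      · rintro ⟨A, rfl, hA⟩
        exact ⟨_, hA, by rw [hmap]⟩
  have hs : ∀ D ∈ δ.head, ∃ A, D = {A} := fun D hD => by
    obtain ⟨A, h, -⟩ := (hrep.head D).1 hD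
    exact ⟨A, h⟩
  have hifc : δ.HasIFC := by
    intro D hD
    obtain ⟨A, rfl, hA⟩ := (hrep.head D).1 hD
    rw [DisTGD.fullPart_singleton_of_mem (hrep.mem_bodyVars hreg hA)]
    exact Finset.singleton_nonempty _
  refine ⟨δ.ifc hifc, ⟨δ, ⟨σ, hσ, g, hg, ?_, ?_, hbody, rfl⟩, hifc, rfl⟩, ?_⟩
  · rintro t ⟨ht, A, hA, i, rfl⟩
    exact absurd ⟨i, ht⟩ (hf.2 A hA)
  · intro A hA i hi
    exact absurd ⟨i, hi⟩ (hf.2 A hA)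
  · rw [DisTGD.ifc_eq_self hifc hs]
    exact hrep

theorem isFull_of_mem_DGSat {τ : DisTGD (shnfSchema Γ)} (h : τ ∈ DGSat Γ) : τ.IsFull := by
  obtain ⟨δ, -, hifc, rfl⟩ := h
  exact DisTGD.ifc_isFull hifc

/-- With single-atom disjuncts, a rule having an immediate full consequence is already full.
Skolemisation then only reinterprets it, and the variable normal form is the required renaming. -/
theorem exists_isVariant_of_mem_IFC (hΓ : ∀ τ ∈ Γ, τ.IsGuarded) {τ : DisTGD (shnfSchema Γ)}
    (h : τ ∈ IFC (SHNF Γ)) : ∃ τ' ∈ DGSat Γ, τ.IsVariant τ' := by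
  classical
  obtain ⟨τ, hτ, hifc, rfl⟩ := h
  have hs : ∀ D ∈ τ.head, ∃ A, D = {A} := fun D hD => exists_eq_singleton_of_mem_SHNF hτ hD
  rw [DisTGD.ifc_eq_self hifc hs]
  have hreg := (isGuarded_of_mem_SHNF hΓ hτ).regular_skolemise.1
  set σ := τ.skolemise with hσ
  have hargs : ∀ A : Atom (shnfSchema Γ) ℕ, {A} ∈ τ.head → ∀ i, A.args i ∈ τ.bodyVars :=
    fun A hA => (DisTGD.fullPart_singleton (hifc _ hA)).1
  have hterm : ∀ A : Atom (shnfSchema Γ) ℕ, {A} ∈ τ.head →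
      A.map (τ.skolemTerm {A}) = A.map Term.var := by
    intro A hA
    refine Atom.map_congr fun i => ?_
    rw [DisTGD.skolemTerm, if_pos (hargs A hA i)]
  have hhead : ∀ A, A ∈ σ.head ↔ ∃ A' : Atom (shnfSchema Γ) ℕ, {A'} ∈ τ.head ∧ A = A'.map Term.var := by
    intro A
    rw [hσ, DisTGD.skolemise, Finset.mem_biUnion]
    constructor
    · rintro ⟨D, hD, hA⟩
      obtain ⟨A', rfl⟩ := hs D hD
      obtain ⟨A'', hA'', rfl⟩ := Finset.mem_image.1 hA
      cases Finset.mem_singleton.1 hA''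
      exact ⟨A', hD, hterm A' hD⟩
    · rintro ⟨A', hA', rfl⟩
      exact ⟨_, hA', Finset.mem_image.2 ⟨A', Finset.mem_singleton_self _, hterm A' hA'⟩⟩
  have hbody : ∀ A, A ∈ σ.body ↔ ∃ A' ∈ τ.body, A = A'.map Term.var := by
    intro A
    rw [hσ, DisTGD.skolemise, Finset.mem_image]
    simp only [eq_comm]
  have hvars : ∀ x ∈ τ.vars, x ∈ σ.vars := by
    intro x hx
    rcases Finset.mem_union.1 hx with hx | hx
    · obtain ⟨A, hA, hi⟩ := mem_conjVars.1 hx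
      exact SkRule.mem_vars_of_mem_body ((hbody _).2 ⟨A, hA, rfl⟩) (Atom.mem_varList_map_var.2 hi)
    · obtain ⟨D, hD, hx⟩ := Finset.mem_biUnion.1 hx
      obtain ⟨A, rfl⟩ := hs D hD
      obtain ⟨B, hB, hi⟩ := mem_conjVars.1 hx
      cases Finset.mem_singleton.1 hB
      exact SkRule.mem_vars_of_mem_head ((hhead _).2 ⟨A, hD, rfl⟩) (Atom.mem_varList_map_var.2 hi)
  set ρ : ℕ → ℕ := fun x => σ.bodyVarList.idxOf x with hρ
  have hren : ∀ A : Atom (shnfSchema Γ) ℕ,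
      (A.map Term.var).subst (fun x => Term.var (ρ x)) = (A.map ρ).map Term.var := fun A => rfl
  have hvb : ∀ A, A ∈ σ.vnf.body ↔ ∃ A' ∈ τ.body, A = (A'.map ρ).map Term.var := by
    intro A
    refine Finset.mem_image.trans ?_
    constructor
    · rintro ⟨A₁, hA₁, rfl⟩
      obtain ⟨A', hA', rfl⟩ := (hbody _).1 hA₁
      exact ⟨A', hA', rfl⟩
    · rintro ⟨A', hA', rfl⟩
      exact ⟨_, (hbody _).2 ⟨A', hA', rfl⟩, rfl⟩
  have hvh : ∀ A, A ∈ σ.vnf.head ↔ ∃ A' : Atom (shnfSchema Γ) ℕ, {A'} ∈ τ.head ∧ A = (A'.map ρ).map Term.var := by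
    intro A
    refine Finset.mem_image.trans ?_
    constructor
    · rintro ⟨A₁, hA₁, rfl⟩
      obtain ⟨A', hA', rfl⟩ := (hhead _).1 hA₁
      exact ⟨A', hA', rfl⟩
    · rintro ⟨A', hA', rfl⟩
      exact ⟨_, (hhead _).2 ⟨A', hA', rfl⟩, rfl⟩
  have hfull : σ.vnf.IsFull := by
    constructor
    · intro A hA
      obtain ⟨A', -, rfl⟩ := (hvb A).1 hA
      exact Atom.not_isFunctional_map_var _
    · intro A hA
      obtain ⟨A', -, rfl⟩ := (hvh A).1 hA
      exact Atom.not_isFunctional_map_var _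
  obtain ⟨τ', hτ', hrep⟩ := exists_mem_DGSat_of_isFull hΓ (DGSatEx.base τ hτ) hfull
  refine ⟨τ', hτ', ρ, hreg.injOn_idxOf.mono fun x hx => hvars x hx, ?_, ?_⟩
  · ext A
    have h1 := hrep.mem_body (A.map Term.var)
    rw [hvb] at h1
    simp only [Atom.map_var_injective.eq_iff] at h1
    rw [Finset.mem_image]
    constructor
    · intro hA
      obtain ⟨A', hA', rfl⟩ := h1.2 ⟨A, hA, rfl⟩
      exact ⟨A', hA', rfl⟩
    · rintro ⟨A', hA', rfl⟩
      obtain ⟨A'', hA'', h2⟩ := h1.1 ⟨A', hA', rfl⟩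
      rw [h2]
      exact hA''
  · ext1 D
    rw [hrep.head, Finset.mem_image]
    constructor
    · rintro ⟨A, rfl, hA⟩
      obtain ⟨A', hA', h2⟩ := (hvh _).1 hA
      refine ⟨{A'}, hA', ?_⟩
      rw [Finset.image_singleton, Atom.map_var_injective h2]
    · rintro ⟨D', hD', rfl⟩
      obtain ⟨A', rfl⟩ := hs D' hD'
      exact ⟨A'.map ρ, Finset.image_singleton _ _, (hvh _).2 ⟨A', hD', rfl⟩⟩

end Translation

/-! ## Chase trees for full rules and their models -/

section Chase

variable {S : Schema.{u}} {K : Type v}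

theorem DisTGD.IsFull.mem_bodyVars {τ : DisTGD S} (hτ : τ.IsFull) {D : Finset (Atom S ℕ)}
    (hD : D ∈ τ.head) {A : Atom S ℕ} (hA : A ∈ D) (i : Fin (S.arity A.rel)) :
    A.args i ∈ τ.bodyVars := by
  by_contra hcon
  have h1 : A.args i ∈ τ.exVars D := DisTGD.mem_exVars.2 ⟨⟨A, hA, i, rfl⟩, hcon⟩
  rw [hτ D hD] at h1
  exact Finset.notMem_empty _ h1

/-- By finitely many applications of rules of `Γ'` to a single bag, a disjunct of `Q` is obtained in
every case. -/
inductive Derives (Γ' : Set (DisTGD S)) (Q : Set (Set (Atom S K))) : Set (Atom S K) → Prop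
  | base (M : Set (Atom S K)) (q : Set (Atom S K)) (hq : q ∈ Q) (h : q ⊆ M) : Derives Γ' Q M
  | step (M : Set (Atom S K)) (τ : DisTGD S) (hτ : τ ∈ Γ') (h : ℕ → K)
      (hb : ∀ B ∈ τ.body, B.map h ∈ M)
      (hD : ∀ D ∈ τ.head, Derives Γ' Q (M ∪ {F | ∃ A ∈ D, F = A.map h})) : Derives Γ' Q M

variable {Γ' : Set (DisTGD S)} {Q : Set (Set (Atom S K))}

theorem Derives.mono {M M' : Set (Atom S K)} (h : Derives Γ' Q M) (hM : M ⊆ M') :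
    Derives Γ' Q M' := by
  induction h generalizing M' with
  | base M q hq h => exact .base M' q hq (h.trans hM)
  | step M τ hτ h hb _ ih =>
    exact .step M' τ hτ h (fun B hB => hM (hb B hB)) fun D hD =>
      ih D hD (Set.union_subset_union_left _ hM)

theorem finite_image_conj (D : Finset (Atom S ℕ)) (h : ℕ → K) :
    {F : Atom S K | ∃ A ∈ D, F = A.map h}.Finite := by
  refine (D.finite_toSet.image (Atom.map h)).subset ?_
  rintro F ⟨A, hA, rfl⟩
  exact ⟨A, hA, rfl⟩

/-- Compactness relative to a possibly infinite `N`: a derivation branches finitely, fires finite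
bodies, and ends in disjuncts that exceed `N` by finitely many facts. -/
theorem Derives.exists_finite {M N : Set (Atom S K)} (hQ : ∀ q ∈ Q, (q \ N).Finite)
    (h : Derives Γ' Q M) : ∃ F ⊆ M, F.Finite ∧ Derives Γ' Q (N ∪ F) := by
  induction h with
  | base M q hq h =>
    refine ⟨q \ N, Set.sdiff_subset.trans h, hQ q hq, .base _ q hq fun x hx => ?_⟩
    by_cases hxN : x ∈ N
    · exact Or.inl hxN
    · exact Or.inr ⟨hx, hxN⟩
  | step M τ hτ h hb _ ih =>
    choose! F hF hFfin hFd using ih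
    -- The body facts of this step, together with what the branches need beyond the facts that the
    -- step adds to them.
    refine ⟨{A | ∃ B ∈ τ.body, A = B.map h} ∪
      ⋃ D ∈ τ.head, (F D \ {A | ∃ B ∈ D, A = B.map h}), ?_, ?_, ?_⟩
    · refine Set.union_subset ?_ (Set.iUnion₂_subset fun D hD => ?_)
      · rintro _ ⟨B, hB, rfl⟩
        exact hb B hB
      · rintro A ⟨hA, hA'⟩
        exact (hF D hD hA).resolve_right hA'
    · refine (finite_image_conj _ _).union ?_
      exact Set.Finite.biUnion τ.head.finite_toSet fun D hD => (hFfin D hD).subset Set.sdiff_subset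
    · refine .step _ τ hτ h (fun B hB => Or.inr (Or.inl ⟨B, hB, rfl⟩)) fun D hD => ?_
      refine (hFd D hD).mono ?_
      rintro A (hA | hA)
      · exact Or.inl (Or.inl hA)
      · by_cases hA' : A ∈ {A | ∃ B ∈ D, A = B.map h}
        · exact Or.inr hA'
        · exact Or.inl (Or.inr (Or.inr (Set.mem_biUnion (Finset.mem_coe.2 hD) ⟨hA, hA'⟩)))

/-- If `Q` cannot be derived from `N`, then there is a model of the full rules extending `N` that
contains no disjunct of `Q`. -/
theorem exists_model_of_not_derives (hfull : ∀ τ ∈ Γ', τ.IsFull) {N : Set (Atom S K)}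
    (hQ : ∀ q ∈ Q, (q \ N).Finite) (hN : ¬ Derives Γ' Q N) :
    ∃ M, N ⊆ M ∧ (∀ F ∈ M, ∀ c ∈ F.consts, ∃ G ∈ N, c ∈ G.consts) ∧ (∀ q ∈ Q, ¬ q ⊆ M) ∧
      ∀ τ ∈ Γ', ∀ h : ℕ → K, (∀ B ∈ τ.body, B.map h ∈ M) →
        ∃ D ∈ τ.head, ∀ A ∈ D, A.map h ∈ M := by
  obtain ⟨M, hNM, hM⟩ := zorn_subset_nonempty
    {M : Set (Atom S K) | N ⊆ M ∧ (∀ F ∈ M, ∀ c ∈ F.consts, ∃ G ∈ N, c ∈ G.consts) ∧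
      ¬ Derives Γ' Q M} (by
      intro C hC hch hne
      obtain ⟨s₀, hs₀⟩ := hne
      refine ⟨⋃₀ C, ⟨(hC hs₀).1.trans (Set.subset_sUnion_of_mem hs₀), ?_, ?_⟩,
        fun s hs => Set.subset_sUnion_of_mem hs⟩
      · rintro F ⟨s, hs, hF⟩
        exact (hC hs).2.1 F hF
      · intro hd
        obtain ⟨F, hF, hFfin, hFd⟩ := hd.exists_finite (N := s₀) fun q hq =>
          (hQ q hq).subset (Set.sdiff_subset_sdiff_right (hC hs₀).1)
        obtain ⟨s, hs, hFs⟩ := hch.directedOn.exists_mem_subset_of_finite_of_subset_sUnion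
          ⟨s₀, hs₀⟩ hFfin hF
        rcases hch.total hs hs₀ with h | h
        · exact (hC hs₀).2.2 (hFd.mono (Set.union_subset subset_rfl (hFs.trans h)))
        · exact (hC hs).2.2 (hFd.mono (Set.union_subset h hFs)))
    N ⟨subset_rfl, fun F hF c hc => ⟨F, hF, hc⟩, hN⟩
  refine ⟨M, hNM, hM.prop.2.1, fun q hq h => hM.prop.2.2 (.base M q hq h), fun τ hτ h hb => ?_⟩
  by_contra hcon
  push Not at hcon
  -- If no disjunct holds in `M`, each one enlarges `M` properly, so by maximality `Q` is derivable
  -- in every branch and hence from `M`.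
  refine hM.prop.2.2 (.step M τ hτ h hb fun D hD => ?_)
  by_contra hd
  obtain ⟨A, hA, hAM⟩ := hcon D hD
  refine hAM (hM.le_of_ge (y := M ∪ {F | ∃ A ∈ D, F = A.map h})
    ⟨hNM.trans Set.subset_union_left, ?_, hd⟩ Set.subset_union_left
    (Or.inr ⟨A, hA, rfl⟩))
  rintro F (hF | ⟨B, hB, rfl⟩)
  · exact hM.prop.2.1 F hF
  · rintro c ⟨i, rfl⟩
    obtain ⟨B', hB', j, hj⟩ := mem_conjVars.1 ((hfull τ hτ).mem_bodyVars hD hB i)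
    exact hM.prop.2.1 _ (hb B' hB') _ ⟨j, congrArg h hj⟩

/-! ### Facts and bags along a chase tree -/

theorem TreeInst.mem_facts_propagate {I : TreeInst S K} {F : Atom S K} :
    F ∈ I.propagate.facts → F ∈ I.facts := by
  rintro ⟨p, -, hF⟩
  exact hF.1

theorem TreeInst.facts_addFacts_subset {I : TreeInst S K} {p : List ℕ} {X : Set (Atom S K)} :
    (I.addFacts p X).facts ⊆ I.facts ∪ X := by
  rintro F ⟨q, hq, hF⟩
  change F ∈ Function.update I.bag p (I.bag p ∪ X) q at hF
  by_cases hqp : q = p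
  · subst hqp
    rw [Function.update_self] at hF
    exact hF.imp (fun h => ⟨q, hq, h⟩) id
  · rw [Function.update_of_ne hqp] at hF
    exact Or.inl ⟨q, hq, hF⟩

theorem TreeInst.facts_addNode_subset {I : TreeInst S K} {p : List ℕ} {X : Set (Atom S K)} :
    (I.addNode p X).facts ⊆ I.facts ∪ X := by
  rintro F ⟨q, hq, hF⟩
  change F ∈ Function.update I.bag p X q at hF
  by_cases hqp : q = p
  · subst hqp
    rw [Function.update_self] at hF
    exact Or.inr hF
  · rw [Function.update_of_ne hqp] at hF
    exact Or.inl ⟨q, (Finset.mem_insert.1 hq).resolve_left hqp, hF⟩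

namespace ChaseStep

variable {I : TreeInst S K}

theorem facts_child_subset (s : ChaseStep I) (D : Finset (Atom S ℕ)) :
    (s.child D).facts ⊆ I.facts ∪ s.newFacts D := by
  intro F hF
  unfold child at hF
  split_ifs at hF
  · exact TreeInst.facts_addFacts_subset (TreeInst.mem_facts_propagate hF)
  · exact TreeInst.facts_addNode_subset (TreeInst.mem_facts_propagate hF)

theorem nodes_subset_child (s : ChaseStep I) (D : Finset (Atom S ℕ)) :
    I.nodes ⊆ (s.child D).nodes := by
  unfold child
  split_ifs
  · exact subset_rfl
  · exact Finset.subset_insert _ _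

end ChaseStep

/-- Provides the finiteness hypothesis of the compactness argument: each disjunct of the query
exceeds `N` by finitely many facts. -/
theorem ChaseTree.finite_facts_sdiff {I : TreeInst S K} (T : ChaseTree I) {L : TreeInst S K}
    (hL : L ∈ T.leaves) : I.nodes ⊆ L.nodes ∧ (L.facts \ I.facts).Finite := by
  induction T with
  | leaf I =>
    cases (hL : L = I)
    simp
  | fire s sub ih =>
    obtain ⟨D, hD, hL⟩ := hL
    obtain ⟨h1, h2⟩ := ih D hD hL
    refine ⟨(s.nodes_subset_child D).trans h1,
      (h2.union (finite_image_conj D (s.ext D))).subset ?_⟩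
    rintro F ⟨hF, hFI⟩
    by_cases hFc : F ∈ (s.child D).facts
    · exact Or.inr ((s.facts_child_subset D hFc).resolve_left hFI)
    · exact Or.inl ⟨hF, hFc⟩

/-- Derivations from a single bag are chase trees. -/
theorem Derives.exists_chaseTree (hfull : ∀ τ ∈ Γ', τ.IsFull) {M : Set (Atom S K)}
    (h : Derives Γ' Q M) : ∀ I : TreeInst S K, I.nodes = {[]} → I.bag [] = M →
      ∃ T : ChaseTree I, T.EveryStep (fun τ _ => τ ∈ Γ') ∧ T.Models Q := by
  classical
  induction h with
  | base M q hq h =>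
    intro I hn hb
    refine ⟨.leaf I, trivial, fun L hL => ⟨q, hq, ?_⟩⟩
    cases (hL : L = I)
    intro F hF
    exact ⟨[], by simp [hn], by rw [hb]; exact h hF⟩
  | step M τ hτ h hbody hD ih =>
    intro I hn hb
    have hex : ∀ D ∈ τ.head, τ.exVars D = ∅ := hfull τ hτ
    let s : ChaseStep I :=
      { rule := τ
        node := []
        node_mem := by simp [hn]
        trigger := h
        trigger_body := by rw [hb]; exact hbody
        ext := fun _ => h
        ext_eq := fun _ _ _ _ => rfl
        ext_fresh := fun D hD y hy => by rw [hex D hD] at hy; simp at hy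
        ext_inj := fun D hD => by rw [hex D hD]; simp
        label := 0
        label_fresh := by simp [hn] }
    have hchild : ∀ D ∈ τ.head, (s.child D).nodes = {[]} ∧
        (s.child D).bag [] = M ∪ {F | ∃ A ∈ D, F = A.map h} := by
      intro D hD
      have h1 : s.child D = (I.addFacts [] (s.newFacts D)).propagate := if_pos (hex D hD)
      have h2 : (I.addFacts [] (s.newFacts D)).bag [] = M ∪ {F | ∃ A ∈ D, F = A.map h} := by
        show Function.update I.bag [] (I.bag [] ∪ s.newFacts D) [] = _
        rw [Function.update_self, hb]
        rfl
      rw [h1]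
      refine ⟨hn, ?_⟩
      rw [← h2]
      ext F
      constructor
      · rintro ⟨⟨p, hp, hF⟩, -⟩
        change p ∈ I.nodes at hp
        rw [hn, Finset.mem_singleton] at hp
        subst hp
        exact hF
      · intro hF
        exact ⟨⟨[], by show [] ∈ I.nodes; simp [hn], hF⟩, F, hF, subset_rfl⟩
    have hsub : ∀ D, ∀ hD : D ∈ s.rule.head, ∃ T : ChaseTree (s.child D),
        T.EveryStep (fun τ _ => τ ∈ Γ') ∧ T.Models Q :=
      fun D hD => ih D hD _ (hchild D hD).1 (hchild D hD).2
    choose sub hsub1 hsub2 using hsub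
    refine ⟨.fire s sub, ⟨hτ, hsub1⟩, ?_⟩
    rintro L ⟨D, hD, hL⟩
    exact hsub2 D hD L hL

/-- If rules are only fired in the node `v`, whose bag is contained in the model `W`, then some leaf
of the chase tree has its root bag in `M`. -/
theorem ChaseTree.exists_leaf_bag_subset {v : List ℕ} (hv : v ≠ []) {M W : Set (Atom S K)}
    (hW : ∀ τ ∈ Γ', ∀ h : ℕ → K, (∀ B ∈ τ.body, B.map h ∈ W) → ∃ D ∈ τ.head, ∀ A ∈ D, A.map h ∈ W)
    (hWM : ∀ F ∈ W, ∀ G ∈ M, F.consts ⊆ G.consts → F ∈ M)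
    (hMW : ∀ F ∈ M, ∀ G ∈ W, F.consts ⊆ G.consts → F ∈ W) {I : TreeInst S K} (T : ChaseTree I)
    (hT : T.EveryStep fun τ p => τ ∈ Γ' ∧ τ.IsFull ∧ p = v) (hn : ∀ p ∈ I.nodes, p = [] ∨ p = v)
    (hIM : I.bag [] ⊆ M) (hIW : I.bag v ⊆ W) : ∃ L ∈ T.leaves, L.bag [] ⊆ M := by
  induction T with
  | leaf I => exact ⟨I, rfl, hIM⟩
  | @fire I s sub ih =>
    obtain ⟨⟨hτ, hfull, hnode⟩, hsub⟩ := hT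
    -- Follow a disjunct that holds in `W`. The root bag stays in `M` and the bag of `v` in `W`, and
    -- `hWM` and `hMW` preserve this under propagation.
    obtain ⟨D, hD, hDW⟩ := hW _ hτ s.trigger (by
      intro B hB
      have := s.trigger_body B hB
      rw [hnode] at this
      exact hIW this)
    have hnew : s.newFacts D ⊆ W := by
      rintro _ ⟨A, hA, rfl⟩
      rw [Atom.map_congr fun i => s.ext_eq D hD _ (hfull.mem_bodyVars hD hA i)]
      exact hDW A hA
    have hchild : s.child D = (I.addFacts v (s.newFacts D)).propagate := by
      rw [ChaseStep.child, if_pos (hfull D hD), hnode]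
    have hbv : (I.addFacts v (s.newFacts D)).bag v ⊆ W := by
      show Function.update I.bag v (I.bag v ∪ s.newFacts D) v ⊆ W
      rw [Function.update_self]
      exact Set.union_subset hIW hnew
    have hb0 : (I.addFacts v (s.newFacts D)).bag [] ⊆ M := by
      show Function.update I.bag v (I.bag v ∪ s.newFacts D) [] ⊆ M
      rw [Function.update_of_ne hv.symm]
      exact hIM
    have hfacts : (I.addFacts v (s.newFacts D)).facts ⊆ M ∪ W := by
      rintro F ⟨p, hp, hF⟩
      rcases hn p hp with rfl | rfl
      · exact Or.inl (hb0 hF)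
      · exact Or.inr (hbv hF)
    obtain ⟨L, hL, hLM⟩ := ih D hD (hsub D hD) (by rw [hchild]; exact hn) (by
      rw [hchild]
      rintro F ⟨hF, G, hG, hFG⟩
      rcases hfacts hF with h | h
      · exact h
      · exact hWM F h G (hb0 hG) hFG) (by
      rw [hchild]
      rintro F ⟨hF, G, hG, hFG⟩
      rcases hfacts hF with h | h
      · exact hMW F h G (hbv hG) hFG
      · exact h)
    exact ⟨L, ⟨D, hD, hL⟩, hLM⟩

end Chase

/-! ## Evolve-completeness of the saturation -/

section Evolve

variable {S : Schema.{u}} {Γ : Set (DisTGD S)} {K : Type v}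

open Classical in
/-- The term that denotes a constant after a chase step: the constants of the trigger are represented
by variables, and the fresh constants by Skolem terms. -/
noncomputable def ChaseStep.code {S : Schema.{u}} {K : Type v} {I : TreeInst S K} (s : ChaseStep I)
    (ι : K → ℕ) (D : Finset (Atom S ℕ)) (k : K) : Term S :=
  if k ∈ s.trigger '' s.rule.bodyVars then Term.var (ι k)
  else if hy : ∃ y ∈ s.rule.exVars D, s.ext D y = k then
    Term.app ⟨s.rule, D, hy.choose⟩
      (fun i => Term.var (ι (s.trigger (s.rule.bodyVars.orderEmbOfFin rfl i))))
  else Term.var 0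

/-- The argument list of the Skolem terms in `ChaseStep.code`. -/
noncomputable def ChaseStep.codeArgs {S : Schema.{u}} {K : Type v} {I : TreeInst S K}
    (s : ChaseStep I) (ι : K → ℕ) : List (Term S) :=
  List.ofFn fun i => Term.var (ι (s.trigger (s.rule.bodyVars.orderEmbOfFin rfl i)))

/-! ### Coding facts as atoms with Skolem terms -/

namespace ChaseStep

variable {S : Schema.{u}} {K : Type v} {I : TreeInst S K} (s : ChaseStep I) {ι : K → ℕ}
  {D : Finset (Atom S ℕ)}

theorem mem_consts_of_mem_trigger {c : K} (hc : c ∈ s.trigger '' s.rule.bodyVars) :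
    c ∈ I.consts := by
  obtain ⟨x, hx, rfl⟩ := hc
  obtain ⟨B, hB, i, rfl⟩ := mem_conjVars.1 hx
  exact ⟨_, ⟨s.node, s.node_mem, s.trigger_body B hB⟩, i, rfl⟩

theorem code_of_mem {k : K} (hk : k ∈ s.trigger '' s.rule.bodyVars) :
    s.code ι D k = Term.var (ι k) := if_pos hk

theorem code_ext_of_mem_exVars (hD : D ∈ s.rule.head) {y : ℕ} (hy : y ∈ s.rule.exVars D) :
    s.code ι D (s.ext D y) = Term.app ⟨s.rule, D, y⟩
      (fun i => Term.var (ι (s.trigger (s.rule.bodyVars.orderEmbOfFin rfl i)))) := by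
  have h1 : s.ext D y ∉ s.trigger '' s.rule.bodyVars := fun h =>
    s.ext_fresh D hD y hy (s.mem_consts_of_mem_trigger h)
  have h2 : ∃ z ∈ s.rule.exVars D, s.ext D z = s.ext D y := ⟨y, hy, rfl⟩
  rw [code, if_neg h1, dif_pos h2]
  have h3 : h2.choose = y := s.ext_inj D hD h2.choose_spec.1 hy h2.choose_spec.2
  rw [h3]

/-- Makes the coded facts of a chase step the head atoms of an instance of the Skolemised rule. -/
theorem code_ext (hD : D ∈ s.rule.head) {x : ℕ} (hx : x ∈ conjVars D) :
    s.code ι D (s.ext D x) =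
      (s.rule.skolemTerm D x).subst fun x => Term.var (ι (s.trigger x)) := by
  by_cases hxb : x ∈ s.rule.bodyVars
  · rw [s.ext_eq D hD x hxb, s.code_of_mem ⟨x, hxb, rfl⟩, DisTGD.skolemTerm, if_pos hxb]
    rfl
  · rw [s.code_ext_of_mem_exVars hD (Finset.mem_sdiff.2 ⟨hx, hxb⟩), DisTGD.skolemTerm, if_neg hxb]
    rfl

theorem code_hasArgs (k : K) : (s.code ι D k).HasArgs (s.codeArgs ι) := by
  unfold code
  split_ifs with h1 h2
  · exact Or.inl ⟨_, rfl⟩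
  · exact Or.inr ⟨_, _, rfl, rfl⟩
  · exact Or.inl ⟨_, rfl⟩

/-- The function-free atoms that represent the facts of `M` over the constants of the trigger. -/
def codeSet (ι : K → ℕ) (M : Set (Atom S K)) : Set (Atom S (Term S)) :=
  {A | ∃ F ∈ M, F.consts ⊆ s.trigger '' s.rule.bodyVars ∧ A = F.map fun c => Term.var (ι c)}

theorem not_isFunctional_of_mem_codeSet {M : Set (Atom S K)} {A : Atom S (Term S)}
    (hA : A ∈ s.codeSet ι M) : ¬ A.IsFunctional := by
  obtain ⟨F, -, -, rfl⟩ := hA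
  exact fun ⟨i, hi⟩ => Term.not_isFunctional_var _ hi

theorem map_code_mem_codeSet {M : Set (Atom S K)} {F : Atom S K} (hF : F ∈ M)
    (hC : F.consts ⊆ s.trigger '' s.rule.bodyVars) : F.map (s.code ι D) ∈ s.codeSet ι M :=
  ⟨F, hF, hC, Atom.map_congr fun i => s.code_of_mem (hC ⟨i, rfl⟩)⟩

/-- Fresh constants have functional codes, which do not occur in `codeSet`; on the remaining
constants the code is injective, so the fact can be recovered. -/
theorem mem_of_map_code_mem_codeSet (hι : Set.InjOn ι (s.trigger '' s.rule.bodyVars))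
    (hD : D ∈ s.rule.head) {M : Set (Atom S K)} {F : Atom S K}
    (hF : ∀ c ∈ F.consts, c ∈ s.trigger '' s.rule.bodyVars ∨ c ∈ s.ext D '' s.rule.exVars D)
    (h : F.map (s.code ι D) ∈ s.codeSet ι M) :
    F ∈ M ∧ F.consts ⊆ s.trigger '' s.rule.bodyVars := by
  have hC : F.consts ⊆ s.trigger '' s.rule.bodyVars := by
    rintro c ⟨i, rfl⟩
    refine (hF _ ⟨i, rfl⟩).resolve_right ?_
    rintro ⟨y, hy, hyi⟩
    refine s.not_isFunctional_of_mem_codeSet h ⟨i, ?_⟩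
    change (s.code ι D (F.args i)).IsFunctional
    rw [← hyi, s.code_ext_of_mem_exVars hD hy]
    exact Term.isFunctional_app _ _
  refine ⟨?_, hC⟩
  obtain ⟨F', hF', hC', heq⟩ := h
  obtain ⟨r, a⟩ := F
  obtain ⟨r', a'⟩ := F'
  simp only [Atom.map, Atom.mk.injEq] at heq
  obtain ⟨rfl, heq⟩ := heq
  have h1 : a = a' := by
    funext i
    have h2 := congrFun (eq_of_heq heq) i
    simp only [Function.comp] at h2
    rw [s.code_of_mem (hC ⟨i, rfl⟩)] at h2
    exact hι (hC ⟨i, rfl⟩) (hC' ⟨i, rfl⟩) (Term.var.inj h2)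
  rw [h1]
  exact hF'

end ChaseStep

/-! ### The evolve condition -/

theorem exists_chaseTree_models_query (hΓ : ∀ τ ∈ Γ, τ.IsGuarded)
    (N : Set (Atom (shnfSchema Γ) K)) (s : ChaseStep (TreeInst.single N))
    (sub : ∀ D, D ∈ s.rule.head → ChaseTree (s.child D)) (hr : s.rule ∈ SHNF Γ)
    (hnonfull : ∀ D, ∀ hD : D ∈ s.rule.head, s.rule.exVars D ≠ ∅ →
      (sub D hD).EveryStep (fun τ p => τ ∈ DGSat Γ ∧ τ.IsFull ∧ p = s.newNode))
    (hfull : ∀ D, ∀ hD : D ∈ s.rule.head, s.rule.exVars D = ∅ → sub D hD = ChaseTree.leaf _) :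
    ∃ T' : ChaseTree (TreeInst.single N), T'.EveryStep (fun τ _ => τ ∈ DGSat Γ) ∧
      T'.Models (ChaseTree.fire s sub).query := by
  classical
  by_contra hno
  have hsingle : (TreeInst.single N).bag [] = N := by
    ext F
    exact and_iff_right rfl
  have hsinglef : (TreeInst.single N).facts = N := by
    ext F
    constructor
    · rintro ⟨p, -, hF⟩
      exact hF.2
    · intro hF
      exact ⟨[], Finset.mem_singleton_self _, rfl, hF⟩
  have hnode : s.node = [] := Finset.mem_singleton.1 s.node_mem
  obtain ⟨M, hNM, hMN, hMQ, hMcl⟩ := exists_model_of_not_derives (Γ' := DGSat Γ)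
    (Q := (ChaseTree.fire s sub).query) (fun τ hτ => isFull_of_mem_DGSat hτ) (N := N) (by
      rintro q ⟨L, hL, rfl⟩
      obtain ⟨h1, h2⟩ := (ChaseTree.fire s sub).finite_facts_sdiff hL
      rw [hsinglef] at h2
      exact h2.subset (Set.sdiff_subset_sdiff_left fun F hF =>
        ⟨[], h1 (Finset.mem_singleton_self _), hF⟩))
    (fun hd => hno (hd.exists_chaseTree (fun τ hτ => isFull_of_mem_DGSat hτ) _ rfl hsingle))
  set C : Set K := s.trigger '' s.rule.bodyVars
  -- Each trigger constant is coded by one body variable mapped to it, which allows for triggers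
  -- that are not injective.
  set ι : K → ℕ := Function.invFunOn s.trigger s.rule.bodyVars
  have hιC : ∀ c ∈ C, s.trigger (ι c) = c := fun c hc => Function.invFunOn_eq hc
  have hι : Set.InjOn ι C := fun c hc c' hc' h => by rw [← hιC c hc, h, hιC c' hc']
  have hfresh : ∀ D ∈ s.rule.head, ∀ y ∈ s.rule.exVars D, ∀ F ∈ M, s.ext D y ∉ F.consts := by
    intro D hD y hy F hF hc
    obtain ⟨G, hG, hcG⟩ := hMN F hF _ hc
    exact s.ext_fresh D hD y hy ⟨G, by rw [hsinglef]; exact hG, hcG⟩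
  have hM : ∀ A ∈ s.codeSet ι M, ¬ A.IsFunctional := fun A => s.not_isFunctional_of_mem_codeSet
  -- Closure of `M` passes to its codes: `h'` decodes `g`, and its value where `g` gives no variable
  -- is irrelevant, because all variables of a regular rule occur in the body.
  have hMhcl : ∀ σ, DGSatEx Γ σ → σ.IsFull → ∀ g, (∀ A ∈ σ.body, A.subst g ∈ s.codeSet ι M) →
      ∃ A ∈ σ.head, A.subst g ∈ s.codeSet ι M := by
    intro σ hσ hσf g hb
    obtain ⟨τ, hτ, hrep⟩ := exists_mem_DGSat_of_isFull hΓ hσ hσf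
    have hreg := hσ.regular hΓ
    set h' : ℕ → K := fun x => if hx : ∃ u, g x = Term.var u then s.trigger hx.choose
      else s.trigger 0 with hh'
    have hh'x : ∀ x u, g x = Term.var u → h' x = s.trigger u := by
      intro x u hu
      have hx : ∃ u, g x = Term.var u := ⟨u, hu⟩
      have h1 : u = hx.choose := Term.var.inj (hu.symm.trans hx.choose_spec)
      simp only [hh', dif_pos hx, ← h1]
    have hbody : ∀ B ∈ τ.body, B.map h' ∈ M ∧ ∀ i, h' (B.args i) ∈ C ∧
        g (B.args i) = Term.var (ι (h' (B.args i))) := by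
      intro B hB
      obtain ⟨F, hF, hFC, hBF⟩ := hb _ ((hrep.mem_body _).2 ⟨B, hB, rfl⟩)
      obtain ⟨r, a⟩ := B
      obtain ⟨r', c⟩ := F
      simp only [Atom.subst, Atom.map, Atom.mk.injEq] at hBF
      obtain ⟨rfl, hBF⟩ := hBF
      have h1 : ∀ i, g (a i) = Term.var (ι (c i)) := fun i => congrFun (eq_of_heq hBF) i
      have h2 : ∀ i, h' (a i) = c i := by
        intro i
        rw [hh'x _ _ (h1 i), hιC _ (hFC ⟨i, rfl⟩)]
      refine ⟨?_, fun i => ?_⟩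
      · have h3 : (⟨r, a⟩ : Atom (shnfSchema Γ) ℕ).map h' = ⟨r, c⟩ := by
          simp only [Atom.map, Atom.mk.injEq, heq_eq_eq, true_and]
          exact funext h2
        rw [h3]
        exact hF
      · change h' (a i) ∈ C ∧ g (a i) = _
        rw [h2 i]
        exact ⟨hFC ⟨i, rfl⟩, h1 i⟩
    obtain ⟨D, hD, hDM⟩ := hMcl τ hτ h' fun B hB => (hbody B hB).1
    obtain ⟨A, rfl, hA⟩ := (hrep.head D).1 hD
    have hargs : ∀ i, h' (A.args i) ∈ C ∧ g (A.args i) = Term.var (ι (h' (A.args i))) := by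
      intro i
      obtain ⟨B, hB, j, hj⟩ := mem_conjVars.1 (hrep.mem_bodyVars hreg hA i)
      rw [← hj]
      exact (hbody B hB).2 j
    refine ⟨_, hA, A.map h', hDM A (Finset.mem_singleton_self _), ?_, ?_⟩
    · rintro c ⟨i, rfl⟩
      exact (hargs i).1
    · rw [Atom.subst_map_var, Atom.map_map]
      exact Atom.map_congr fun i => (hargs i).2
  obtain ⟨X, hXhit, hXmin⟩ := exists_minimal_hittingSet
    {T | ∃ σ g, PosInst Γ (s.codeSet ι M) (s.codeArgs ι) σ g ∧ T = σ.funHead g} (by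
      rintro T ⟨σ, g, -, rfl⟩
      refine (σ.head.image (Atom.subst g)).finite_toSet.subset ?_
      rintro A ⟨-, A', hA', rfl⟩
      exact Finset.mem_coe.2 (Finset.mem_image_of_mem _ hA')) (by
      rintro T ⟨σ, g, hσ, rfl⟩
      by_contra hT
      have hσf : σ.IsFull := by
        refine ⟨fun A hA => Atom.not_isFunctional_of_subst (hM _ (hσ.body A hA)),
          fun A hA => Atom.not_isFunctional_of_subst fun h => hT ⟨_, h, A, hA, rfl⟩⟩
      obtain ⟨A, hA, hAM⟩ := hMhcl σ hσ.mem hσf g hσ.body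
      exact (hσ.head A hA).2 hAM)
  have hX : ∀ A ∈ X, A.IsFunctional := by
    intro A hA
    obtain ⟨T, ⟨σ, g, -, rfl⟩, h⟩ := hXmin A hA
    have h1 : A ∈ σ.funHead g ∩ X := by rw [h]; rfl
    exact h1.1.1
  have hreg := (isGuarded_of_mem_SHNF hΓ hr).regular_skolemise.1
  obtain ⟨g₀, hg₀⟩ := hreg.exists_vnf_subst fun x => Term.var (ι (s.trigger x))
  have hg₀A : ∀ A, (A ∈ s.rule.skolemise.body ∨ A ∈ s.rule.skolemise.head) →
      (A.subst fun x => Term.var (s.rule.skolemise.bodyVarList.idxOf x)).subst g₀ =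
        A.subst fun x => Term.var (ι (s.trigger x)) := by
    intro A hA
    rw [Atom.subst_subst]
    exact Atom.subst_congr fun x hx => hg₀ x ⟨A, hA, hx⟩
  have hnew : ∀ D ∈ s.rule.head, ∀ A ∈ D,
      (A.map (s.rule.skolemTerm D)).subst (fun x => Term.var (ι (s.trigger x))) =
        (A.map (s.ext D)).map (s.code ι D) := by
    intro D hD A hA
    exact Atom.map_congr (f := Term.subst _ ∘ s.rule.skolemTerm D) (g := s.code ι D ∘ s.ext D)
      fun i => (s.code_ext hD (mem_conjVars.2 ⟨A, hA, i, rfl⟩)).symm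
  have hnewc : ∀ D ∈ s.rule.head, ∀ A ∈ D, ∀ c ∈ (A.map (s.ext D)).consts,
      c ∈ C ∨ c ∈ s.ext D '' s.rule.exVars D := by
    rintro D hD A hA c ⟨i, rfl⟩
    by_cases hi : A.args i ∈ s.rule.bodyVars
    · exact Or.inl ⟨_, hi, (s.ext_eq D hD _ hi).symm⟩
    · exact Or.inr ⟨_, DisTGD.mem_exVars.2 ⟨⟨A, hA, i, rfl⟩, hi⟩, rfl⟩
  have hDB : ∀ D ∈ s.rule.head, ∀ B ∈ D, ∀ B' ∈ D, B' = B := by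
    intro D hD B hB B' hB'
    obtain ⟨B₀, rfl⟩ := exists_eq_singleton_of_mem_SHNF hr hD
    rw [Finset.mem_singleton.1 hB', Finset.mem_singleton.1 hB]
  -- No disjunct of the fired rule holds in `M`: a full one would put the root bag of its leaf, a
  -- disjunct of the query, inside `M`, and a non-full one contains a constant foreign to `M`.
  have hpos : PosInst Γ (s.codeSet ι M) (s.codeArgs ι) s.rule.skolemise.vnf g₀ := by
    refine ⟨DGSatEx.base _ hr, ?_, ?_⟩
    · intro A hA
      obtain ⟨A', hA', rfl⟩ := Finset.mem_image.1 hA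
      rw [hg₀A A' (Or.inl hA')]
      obtain ⟨B, hB, rfl⟩ := Finset.mem_image.1 hA'
      refine ⟨B.map s.trigger, hNM ?_, ?_, rfl⟩
      · have := s.trigger_body B hB
        rw [hnode, hsingle] at this
        exact this
      · rintro c ⟨i, rfl⟩
        exact ⟨_, mem_conjVars.2 ⟨B, hB, i, rfl⟩, rfl⟩
    · intro A hA
      obtain ⟨A', hA', rfl⟩ := Finset.mem_image.1 hA
      rw [hg₀A A' (Or.inr hA')]
      obtain ⟨D, hD, hA'⟩ := Finset.mem_biUnion.1 hA'
      obtain ⟨B, hB, rfl⟩ := Finset.mem_image.1 hA'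
      rw [hnew D hD B hB]
      refine ⟨fun i => s.code_hasArgs _, fun hcon => ?_⟩
      obtain ⟨h1, h2⟩ := s.mem_of_map_code_mem_codeSet hι hD (hnewc D hD B hB) hcon
      by_cases hex : s.rule.exVars D = ∅
      · refine hMQ ((s.child D).bag []) ⟨s.child D, ⟨D, hD, ?_⟩, rfl⟩ ?_
        · rw [hfull D hD hex]
          rfl
        · rw [ChaseStep.child, if_pos hex]
          rintro F ⟨hF, -⟩
          rcases TreeInst.facts_addFacts_subset hF with h | ⟨B', hB', rfl⟩
          · rw [hsinglef] at h
            exact hNM h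
          · rw [hDB D hD B hB B' hB']
            exact h1
      · obtain ⟨y, hy⟩ := Finset.nonempty_iff_ne_empty.2 hex
        obtain ⟨⟨B', hB', i, hi⟩, -⟩ := DisTGD.mem_exVars.1 hy
        obtain rfl := hDB D hD B hB B' hB'
        exact hfresh D hD y hy _ h1 ⟨i, congrArg (s.ext D) hi⟩
  -- The hitting set selects the branch: the head conjunction `D` of the chosen functional atom,
  -- which is non-full.
  obtain ⟨A, ⟨hAf, A', hA', rfl⟩, hAX⟩ := hXhit _ ⟨_, _, hpos, rfl⟩
  obtain ⟨A', hAsk, rfl⟩ := Finset.mem_image.1 hA'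
  rw [hg₀A A' (Or.inr hAsk)] at hAf hAX
  obtain ⟨D, hD, hA'⟩ := Finset.mem_biUnion.1 hAsk
  obtain ⟨B, hB, rfl⟩ := Finset.mem_image.1 hA'
  rw [hnew D hD B hB] at hAf hAX
  -- constants of functional facts
  have hfun : ∀ F : Atom (shnfSchema Γ) K, (F.map (s.code ι D)).IsFunctional →
      ∃ c ∈ F.consts, c ∉ C := by
    rintro F ⟨i, hi⟩
    refine ⟨F.args i, ⟨i, rfl⟩, fun h => ?_⟩
    change (s.code ι D (F.args i)).IsFunctional at hi
    rw [s.code_of_mem h] at hi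
    exact Term.not_isFunctional_var _ hi
  obtain ⟨c₀, hc₀, hc₀C⟩ := hfun _ hAf
  obtain ⟨y₀, hy₀, rfl⟩ := (hnewc D hD B hB _ hc₀).resolve_left hc₀C
  have hex : s.rule.exVars D ≠ ∅ := Finset.nonempty_iff_ne_empty.1 ⟨y₀, hy₀⟩
  -- The decoded model M ∪ X, restricted to the constants that may occur in the new node.
  set W : Set (Atom (shnfSchema Γ) K) := {F | (∀ c ∈ F.consts,
    c ∈ C ∨ c ∈ s.ext D '' s.rule.exVars D) ∧ (F ∈ M ∨ F.map (s.code ι D) ∈ X)}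
  have hMC : ∀ F ∈ M, (∀ c ∈ F.consts, c ∈ C ∨ c ∈ s.ext D '' s.rule.exVars D) → F.consts ⊆ C := by
    intro F hF h c hc
    refine (h c hc).resolve_right ?_
    rintro ⟨y, hy, rfl⟩
    exact hfresh D hD y hy F hF hc
  have hchild : s.child D =
      ((TreeInst.single N).addNode s.newNode (s.newFacts D)).propagate := if_neg hex
  have hv : s.newNode ≠ [] := List.cons_ne_nil _ _
  have hfacts : ∀ F ∈ ((TreeInst.single N).addNode s.newNode (s.newFacts D)).facts,
      F ∈ N ∨ F = B.map (s.ext D) := by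
    intro F hF
    rcases TreeInst.facts_addNode_subset hF with h | ⟨B', hB', rfl⟩
    · exact Or.inl (hsinglef ▸ h)
    · exact Or.inr (by rw [hDB D hD B hB B' hB'])
  obtain ⟨L, hL, hLM⟩ := (sub D hD).exists_leaf_bag_subset (Γ' := DGSat Γ) hv (M := M) (W := W)
    (by
      intro τ hτ h' hb
      obtain ⟨σ, hσ, hrep⟩ := exists_represents_of_mem_DGSat hτ
      obtain ⟨A, hA, hAMX⟩ := exists_head_mem_of_full hΓ hM hMhcl
        (fun σ g hσ => hXhit _ ⟨σ, g, hσ, rfl⟩) (fun A hA => by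
          obtain ⟨T, ⟨σ, g, hσ, rfl⟩, h⟩ := hXmin A hA
          exact ⟨σ, g, hσ, h⟩) hσ hrep.isFull (g₂ := fun x => s.code ι D (h' x))
        (fun x _ => s.code_hasArgs _) (by
          intro A hA
          obtain ⟨A', hA', rfl⟩ := (hrep.mem_body A).1 hA
          obtain ⟨h1, h2⟩ := hb A' hA'
          refine h2.imp (fun h2 => ?_) id
          exact s.map_code_mem_codeSet h2 (hMC _ h2 h1))
      obtain ⟨A', rfl⟩ := hrep.mem_head A hA
      refine ⟨{A'}, (hrep.head _).2 ⟨A', rfl, hA⟩, fun A₁ hA₁ => ?_⟩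
      rw [Finset.mem_singleton.1 hA₁]
      have h1 : ∀ c ∈ (A'.map h').consts, c ∈ C ∨ c ∈ s.ext D '' s.rule.exVars D := by
        rintro c ⟨i, rfl⟩
        obtain ⟨B', hB', j, hj⟩ := mem_conjVars.1 (hrep.mem_bodyVars (hσ.regular hΓ) hA i)
        exact (hb B' hB').1 _ ⟨j, congrArg h' hj⟩
      refine ⟨h1, hAMX.imp (fun h2 => ?_) id⟩
      exact (s.mem_of_map_code_mem_codeSet hι hD h1 h2).1)
    (by
      rintro F ⟨hF1, hF2⟩ G hG hFG
      refine hF2.resolve_right fun hFX => ?_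
      obtain ⟨c, hc, hcC⟩ := hfun F (hX _ hFX)
      obtain ⟨y, hy, rfl⟩ := (hF1 c hc).resolve_left hcC
      exact hfresh D hD y hy G hG (hFG hc))
    (fun F hF G hG hFG => ⟨fun c hc => hG.1 c (hFG hc), Or.inl hF⟩)
    (hnonfull D hD hex)
    (by
      intro p hp
      rw [hchild] at hp
      rcases Finset.mem_insert.1 hp with h | h
      · exact Or.inr h
      · exact Or.inl (Finset.mem_singleton.1 h))
    (by
      rw [hchild]
      rintro F ⟨hF, G, hG, hFG⟩
      change G ∈ Function.update (TreeInst.single N).bag s.newNode (s.newFacts D) [] at hG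
      rw [Function.update_of_ne hv.symm, hsingle] at hG
      rcases hfacts F hF with h | rfl
      · exact hNM h
      · exact absurd (hFG hc₀) (hfresh D hD y₀ hy₀ G (hNM hG)))
    (by
      rw [hchild]
      rintro F ⟨hF, G, hG, hFG⟩
      change G ∈ Function.update (TreeInst.single N).bag s.newNode (s.newFacts D) s.newNode at hG
      rw [Function.update_self] at hG
      obtain ⟨B', hB', rfl⟩ := hG
      refine ⟨fun c hc => hnewc D hD B' hB' c (hFG hc), ?_⟩
      rcases hfacts F hF with h | rfl
      · exact Or.inl (hNM h)
      · exact Or.inr hAX)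
  exact hMQ _ ⟨L, ⟨D, hD, hL⟩, rfl⟩ hLM

end Evolve

theorem mainTheorem10 {S : Schema.{u}} (K : Type v) (Γ : Set (DisTGD S))
    (hΓ : ∀ τ ∈ Γ, τ.IsGuarded) : EvolveComplete K (SHNF Γ) (DGSat Γ) where
  full _ hτ := isFull_of_mem_DGSat hτ
  ifc_mem _ hτ := exists_isVariant_of_mem_IFC hΓ hτ
  evolve N s sub hr _ hnonfull hfull :=
    exists_chaseTree_models_query hΓ N s sub hr hnonfull hfull
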